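/- Let $a,b,c,k,r$ be integers with $k\ge c>b>a\ge 1$ and $r\ge 1$. A partition is a finite (possibly empty) non-increasing sequence $\pi=(\pi_1,\dots,\pi_m)$ of positive integers; $|\pi|$ is the sum of its parts and $\ell_{k,d}(\pi)$ is the number of its parts congruent to $d$ modulo $k$. Let $\mathcal R_{a,b,c,k}$ be the set of partitions $\pi=(\pi_1,\dots,\pi_m)$ such that 1. every part is congruent to $a$, $b$ or $c$ modulo $k$; 2. the parts congruent to $c$ modulo $k$ are distinct; 3. for $1\le i<m$, if $\pi_i\equiv a\pmod k$ then $\pi_{i+1}$ is congruent to $a$ or $c$ modulo $k$. Let $\mathcal R_{a,b,c,k,r}$ be the set of partitions in $\mathcal R_{a,b,c,k}$ that have no $r$ consecutive parts which are all congruent to $b$ modulo $k$. Put $(x;q)_n=\prod_{i=0}^{n-1}(1-xq^i)$. For integers $A,B$ and $k\ge1$ let $${A\brack B}_k=\frac{(q^k;q^k)_A}{(q^k;q^k)_B(q^k;q^k)_{A-B}}\ \text{ if } A\ge B\ge 0,\qquad {A\brack B}_k=0\ \text{ otherwise},$$ and for $h\ge0$, $s\ge1$ let $$g_{k,r}(h,s)=\sum_{i\ge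 0}(-1)^iq^{rk(i^2-i)/2}{s\brack i}_{rk}{h-ri+s-1\brack s-1}_k .$$ Let $\mathbb K$ be a field that is complete with respect to a multiplicative norm $|\cdot|$ (for example $\mathbb K=\mathbb C$; or, for the identities between formal series in $q$, the field of formal Laurent series in $q$ over $\mathbb Q(\mu,\nu,\omega)$ with its $q$-adic norm), and let $\mu,\nu,\omega,q\in\mathbb K$ with $|q|<1$ and $|\mu q^a|<1$. If also $|\nu q^b|<1$, then $$\sum_{\pi\in\mathcal R_{a,b,c,k}}\mu^{\ell_{k,a}(\pi)}\nu^{\ell_{k,b}(\pi)}\omega^{\ell_{k,c}(\pi)}q^{|\pi|} =1+\sum_{m\ge 1}\frac{1}{(q^k;q^k)_m}\sum_{s,h\ge 0}\mu^{m-h-s}\nu^h\omega^sq^{(m-h-s)a+hb+sc+k(s^2-s)/2}{h+s\brack s}_k{m-h\brack s}_k .$$ Without that additional condition, $$\sum_{\pi\in\mathcal R_{a,b,c,k,r}}\mu^{\ell_{k,a}(\pi)}\nu^{\ell_{k,b}(\pi)}\omega^{\ell_{k,c}(\pi)}q^{|\pi|} =1+\sum_{m\ge 1}\frac{1}{(q^k;q^k)_m}\sum_{s,h\ge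 0}\mu^{m-h-s}\nu^h\omega^sq^{(m-h-s)a+hb+sc+k(s^2-s)/2}{m-h\brack s}_k\,g_{k,r}(h,s+1).$$ In both formulas the sum over partitions and the sum over $m$ are (unconditionally) summable; the sums over $s,h$ and over $i$ have only finitely many nonzero terms, a term whose $q$-binomial coefficient vanishes being read as $0$. -/

import Mathlib

/-- The `q`-shifted factorial `(x;q)_n = (1 - x)(1 - xq)⋯(1 - xq^(n-1))`. -/
def qPochhammer {𝕜 : Type*} [Field 𝕜] (x q : 𝕜) (n : ℕ) : 𝕜 :=
  ∏ i ∈ Finset.range n, (1 - x * q ^ i)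

/-- The Gaussian binomial `[A over B]_k` in base `q^k`, for integers `A` and `B`; it is `0`
unless `A ≥ B ≥ 0`. -/
def qBinom {𝕜 : Type*} [Field 𝕜] (q : 𝕜) (k : ℕ) (A B : ℤ) : 𝕜 :=
  if 0 ≤ B ∧ B ≤ A then
    qPochhammer (q ^ k) (q ^ k) A.toNat /
      (qPochhammer (q ^ k) (q ^ k) B.toNat * qPochhammer (q ^ k) (q ^ k) (A - B).toNat)
  else 0

/-- `g_{k,r}(h,s) = ∑_{i ≥ 0} (-1)^i q^(rk(i²-i)/2) [s, i]_{rk} [h - ri + s - 1, s - 1]_k`.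
Only the terms with `i ≤ s` can be nonzero, and the division by `2` is exact. -/
noncomputable def gSum {𝕜 : Type*} [NormedField 𝕜] (q : 𝕜) (k r : ℕ) (h s : ℤ) : 𝕜 :=
  ∑' i : ℕ, (-1) ^ i * q ^ ((r : ℤ) * k * ((i : ℤ) ^ 2 - i) / 2) *
    qBinom q (r * k) s i * qBinom q k (h - r * i + s - 1) (s - 1)

/-- A partition, written as the non-increasing list of its (positive) parts. -/
def IsPartition (π : List ℕ) : Prop :=
  π.Pairwise (· ≥ ·) ∧ ∀ x ∈ π, 0 < x

/-- `ℓ_{k,d}(π)`, the number of parts of `π` that are congruent to `d` modulo `k`. -/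
def numParts (k d : ℕ) (π : List ℕ) : ℕ :=
  π.countP (fun x => decide (x ≡ d [MOD k]))

/-- The class `R_{a,b,c,k}`. -/
def classR (a b c k : ℕ) : Set (List ℕ) :=
  {π | IsPartition π ∧
    (∀ x ∈ π, x ≡ a [MOD k] ∨ x ≡ b [MOD k] ∨ x ≡ c [MOD k]) ∧
    (π.filter (fun x => decide (x ≡ c [MOD k]))).Nodup ∧
    ∀ (i : ℕ) (hi : i + 1 < π.length),
      π[i] ≡ a [MOD k] → π[i + 1] ≡ a [MOD k] ∨ π[i + 1] ≡ c [MOD k]}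

/-- The class `R_{a,b,c,k,r}`: no `r` consecutive parts are all congruent to `b` modulo `k`
(`l <:+: π` says that `l` is a block of consecutive entries of `π`). -/
def classRr (a b c k r : ℕ) : Set (List ℕ) :=
  {π | π ∈ classR a b c k ∧
    ¬ ∃ l : List ℕ, l <:+: π ∧ l.length = r ∧ ∀ x ∈ l, x ≡ b [MOD k]}

/-- The weight `μ^{ℓ_{k,a}(π)} ν^{ℓ_{k,b}(π)} ω^{ℓ_{k,c}(π)} q^{|π|}` of a partition `π`. -/
def partWeight {𝕜 : Type*} [Field 𝕜] (μ ν ω q : 𝕜) (a b c k : ℕ) (π : List ℕ) : 𝕜 :=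
  μ ^ numParts k a π * ν ^ numParts k b π * ω ^ numParts k c π * q ^ π.sum

/-- The factor `μ^(m-h-s) ν^h ω^s q^((m-h-s)a + hb + sc + k(s²-s)/2)`, with integer exponents;
the division by `2` is exact. -/
def monomialFactor {𝕜 : Type*} [Field 𝕜] (μ ν ω q : 𝕜) (a b c k m s h : ℕ) : 𝕜 :=
  μ ^ ((m : ℤ) - h - s) * ν ^ h * ω ^ s *
    q ^ (((m : ℤ) - h - s) * a + h * b + s * c + (k : ℤ) * ((s : ℤ) ^ 2 - s) / 2)

/-- The `m`-th summand of the series for `R_{a,b,c,k}`. Only the terms with `s + h ≤ m` can be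
nonzero. -/
noncomputable def termR {𝕜 : Type*} [NormedField 𝕜] (μ ν ω q : 𝕜) (a b c k m : ℕ) : 𝕜 :=
  1 / qPochhammer (q ^ k) (q ^ k) m *
    ∑' s : ℕ, ∑' h : ℕ, monomialFactor μ ν ω q a b c k m s h *
      qBinom q k ((h : ℤ) + s) s * qBinom q k ((m : ℤ) - h) s

/-- The `m`-th summand of the series for `R_{a,b,c,k,r}`. Only the terms with `s + h ≤ m` can be
nonzero. -/
noncomputable def termRr {𝕜 : Type*} [NormedField 𝕜] (μ ν ω q : 𝕜) (a b c k r m : ℕ) : 𝕜 :=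
  1 / qPochhammer (q ^ k) (q ^ k) m *
    ∑' s : ℕ, ∑' h : ℕ, monomialFactor μ ν ω q a b c k m s h *
      qBinom q k ((m : ℤ) - h) s * gSum q k r h ((s : ℤ) + 1)

/-! Put `y = q ^ k` and read a partition upwards from its smallest part. Each part is `k * d + e`
with level `d ≥ 0` and `e` one of `a`, `b`, `c`, so a partition spells a word in `A`, `B`, `C`; the
third condition says that `B` is never followed by `A`. For such a word levels never decrease, they
may stay equal except after a `C`, where distinctness forces the next level up, and there is no
other constraint. Each jump in level lifts all later parts, so the free jumps contribute `1 /
(y;y)_m` and the forced ones `y ^ wordStat` (`hasSum_partsOfWord`).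

The `s` letters `C` cut the word into `s + 1` blocks `A ⋯ A B ⋯ B`. A letter of block `j` (counted
from `0`) follows `j` letters `C` and so contributes `y ^ j`; the letters `C` among themselves
contribute `y ^ (s.choose 2)`. The lengths of the runs of `A` and of `B` are independent, so the sum
over words factors (`sum_validWords`) into two values of `blockSum`. An unrestricted one is a
Gaussian binomial; one with runs shorter than `r` is `gSum`, by the finite `q`-binomial theorem
(`gSum_eq_blockSum`).

Both identities are thus one statement about a downward closed condition `H` on the runs of `B`.
Since the norm of a weight is the weight at the norms, convergence reduces to a bound for real
nonnegative parameters (`summable_countTerm`). -/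

open Finset

/-! ### Gaussian binomials and the finite `q`-binomial theorem. -/

section GaussianBinomial

variable {𝕜 : Type*} [Field 𝕜]

/-- The Gaussian binomial coefficient in base `z`, with natural arguments. -/
def gaussBinom (z : 𝕜) (n i : ℕ) : 𝕜 :=
  if i ≤ n then qPochhammer z z n / (qPochhammer z z i * qPochhammer z z (n - i)) else 0

theorem qPochhammer_zero (x q : 𝕜) : qPochhammer x q 0 = 1 := by
  simp [qPochhammer]

theorem qPochhammer_succ (z : 𝕜) (n : ℕ) :
    qPochhammer z z (n + 1) = qPochhammer z z n * (1 - z ^ (n + 1)) := by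
  simp [qPochhammer, Finset.prod_range_succ, pow_succ']

theorem qBinom_natCast (q : 𝕜) (k n i : ℕ) :
    qBinom q k (n : ℤ) (i : ℤ) = gaussBinom (q ^ k) n i := by
  unfold qBinom gaussBinom
  by_cases h : i ≤ n
  · have h1 : ((n : ℤ) - i).toNat = n - i := by omega
    simp [h, h1]
  · simp [h]

theorem gaussBinom_of_lt (z : 𝕜) {n i : ℕ} (h : n < i) : gaussBinom z n i = 0 := by
  simp [gaussBinom, h]

section NonVanishing

variable {z : 𝕜} (hz : ∀ n, qPochhammer z z n ≠ 0)
include hz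

theorem gaussBinom_zero_right (n : ℕ) : gaussBinom z n 0 = 1 := by
  simp [gaussBinom, qPochhammer_zero, div_self (hz n)]

theorem gaussBinom_self (n : ℕ) : gaussBinom z n n = 1 := by
  simp [gaussBinom, qPochhammer_zero, div_self (hz n)]

theorem one_sub_pow_ne_zero (n : ℕ) : 1 - z ^ (n + 1) ≠ 0 := by
  have := hz (n + 1)
  rw [qPochhammer_succ] at this
  exact right_ne_zero_of_mul this

/-- The `q`-Pascal rule with no natural subtraction; it also matches the recursion of `blockSum`. -/
theorem gaussBinom_add_succ (i j : ℕ) :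
    gaussBinom z (i + j + 2) (i + 1) =
      gaussBinom z (i + j + 1) (i + 1) + z ^ (j + 1) * gaussBinom z (i + j + 1) i := by
  have e1 : i + j + 2 - (i + 1) = j + 1 := by omega
  have e2 : i + j + 1 - (i + 1) = j := by omega
  have e3 : i + j + 1 - i = j + 1 := by omega
  have h1 : i + 1 ≤ i + j + 2 := by omega
  have h2 : i + 1 ≤ i + j + 1 := by omega
  have h3 : i ≤ i + j + 1 := by omega
  simp only [gaussBinom, e1, e2, e3, h1, h2, h3, if_true]
  rw [qPochhammer_succ z (i + j + 1), qPochhammer_succ z i, qPochhammer_succ z j]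
  have a1 := hz i
  have a2 := hz j
  have a3 := one_sub_pow_ne_zero hz i
  have a4 := one_sub_pow_ne_zero hz j
  field_simp
  ring

theorem gaussBinom_succ_succ (n i : ℕ) :
    gaussBinom z (n + 1) (i + 1) =
      gaussBinom z n (i + 1) + z ^ (n - i) * gaussBinom z n i := by
  rcases lt_trichotomy i n with h | h | h
  · obtain ⟨j, rfl⟩ := Nat.exists_eq_add_of_lt h
    rw [show i + j + 1 - i = j + 1 by omega]
    exact gaussBinom_add_succ hz i j
  · subst h
    rw [gaussBinom_self hz, gaussBinom_self hz, gaussBinom_of_lt z (Nat.lt_succ_self i)]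
    simp
  · rw [gaussBinom_of_lt z (by omega), gaussBinom_of_lt z (by omega), gaussBinom_of_lt z h]
    simp

/-- The finite `q`-binomial theorem. -/
theorem prod_one_sub_eq_sum_gaussBinom {R : Type*} [CommRing R] [Algebra 𝕜 R] (x : R) (n : ℕ) :
    ∏ j ∈ range n, (1 - algebraMap 𝕜 R (z ^ j) * x) =
      ∑ i ∈ range (n + 1),
        algebraMap 𝕜 R ((-1) ^ i * z ^ (i.choose 2) * gaussBinom z n i) * x ^ i := by
  induction n with
  | zero => simp [gaussBinom_zero_right hz]
  | succ n ih =>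
    rw [prod_range_succ, ih, sum_range_succ' _ (n + 1), mul_sub, mul_one,
      sum_range_succ' _ n, gaussBinom_zero_right hz, gaussBinom_zero_right hz]
    -- The Pascal rule on coefficients: `z ^ i` from `(i + 1).choose 2 = i.choose 2 + i` completes
    -- `z ^ (n - i)` to `z ^ n`.
    have key : ∀ i ∈ range (n + 1),
        algebraMap 𝕜 R ((-1) ^ (i + 1) * z ^ ((i + 1).choose 2) * gaussBinom z (n + 1) (i + 1)) *
          x ^ (i + 1) =
        algebraMap 𝕜 R ((-1) ^ (i + 1) * z ^ ((i + 1).choose 2) * gaussBinom z n (i + 1)) *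
          x ^ (i + 1) -
        algebraMap 𝕜 R ((-1) ^ i * z ^ (i.choose 2) * gaussBinom z n i) * x ^ i *
          (algebraMap 𝕜 R (z ^ n) * x) := by
      intro i hi
      have hi : i ≤ n := by simpa [Nat.lt_succ_iff] using hi
      have hzn : z ^ n = z ^ i * z ^ (n - i) := by rw [← pow_add]; congr 1; omega
      rw [gaussBinom_succ_succ hz, hzn, show (i + 1).choose 2 = i.choose 2 + i by
        rw [Nat.choose_succ_succ' i 1, Nat.choose_one_right, add_comm]]
      simp only [map_mul, map_add, map_pow, pow_succ, map_neg, map_one, pow_add]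
      ring
    rw [sum_congr rfl key, sum_sub_distrib, ← sum_mul, sum_range_succ _ n,
      gaussBinom_of_lt z (Nat.lt_succ_self n)]
    rw [sum_range_succ' (fun i => algebraMap 𝕜 R ((-1) ^ i * z ^ (i.choose 2) *
      gaussBinom z n i) * x ^ i) n, gaussBinom_zero_right hz]
    simp only [mul_zero, map_zero, zero_mul, add_zero]
    ring

end NonVanishing

end GaussianBinomial

/-! ### Weighted sums over the lengths of `s + 1` runs. -/

section BlockSum

variable {R : Type*} [CommRing R] (H : ℕ → Prop) [DecidablePred H]

/-- `blockSum H y s h` is the sum of `y ^ (h₁ + 2 h₂ + ⋯ + s hₛ)` over all `h₀, …, hₛ` that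
satisfy `H` and have sum `h`. -/
def blockSum (y : R) : ℕ → ℕ → R
  | 0, h => if H h then 1 else 0
  | s + 1, h => ∑ p ∈ antidiagonal h, (if H p.1 then 1 else 0) * (y ^ p.2 * blockSum y s p.2)

open PowerSeries in
theorem mk_blockSum_succ (y : R) (s : ℕ) :
    PowerSeries.mk (blockSum H y (s + 1)) =
      PowerSeries.mk (fun h => if H h then 1 else 0) *
        rescale y (PowerSeries.mk (blockSum H y s)) := by
  ext h
  simp [PowerSeries.coeff_mul, blockSum]

open PowerSeries in
theorem mk_blockSum_eq_prod (y : R) (s : ℕ) :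
    PowerSeries.mk (blockSum H y s) =
      ∏ j ∈ range (s + 1), rescale (y ^ j) (PowerSeries.mk (fun h => if H h then 1 else 0)) := by
  induction s with
  | zero => simp [blockSum]
  | succ s ih =>
    rw [mk_blockSum_succ, prod_range_succ', ih, map_prod, mul_comm]
    congr 1
    · refine prod_congr rfl fun j _ => ?_
      rw [rescale_rescale, pow_succ]
    · simp

/-- Either the first run is nonempty and loses one letter, or it is empty. -/
theorem blockSum_true_succ_succ (y : R) (s l : ℕ) :
    blockSum (fun _ => True) y (s + 1) (l + 1) =
      blockSum (fun _ => True) y (s + 1) l +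
        y ^ (l + 1) * blockSum (fun _ => True) y s (l + 1) := by
  simp only [blockSum, if_true, one_mul]
  rw [Finset.Nat.antidiagonal_succ]
  simp [add_comm]

theorem blockSum_true_zero_right (y : R) (s : ℕ) : blockSum (fun _ => True) y s 0 = 1 := by
  induction s with
  | zero => simp [blockSum]
  | succ s ih => simp [blockSum, ih]

open PowerSeries in
theorem rescale_truncated_geom_mul (y : R) (r : ℕ) :
    (rescale y (PowerSeries.mk (fun h => if h < r then (1 : R) else 0))) * (1 - C y * X) =
      1 - C (y ^ r) * X ^ r := by
  have h1 : rescale y (PowerSeries.mk (fun h => if h < r then (1 : R) else 0)) =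
      ∑ i ∈ range r, (C y * X) ^ i := by
    ext n
    simp only [coeff_rescale, coeff_mk, map_sum, mul_pow, ← map_pow, coeff_C_mul, coeff_X_pow]
    simp
  rw [h1, geom_sum_mul_neg, mul_pow, map_pow]

open PowerSeries in
theorem rescale_geom_mul (y : R) :
    (rescale y (PowerSeries.mk (fun _ => if True then (1 : R) else 0))) * (1 - C y * X) = 1 := by
  ext n
  rw [mul_sub, mul_one, ← mul_assoc, map_sub]
  cases n with
  | zero => simp
  | succ n =>
    rw [coeff_succ_mul_X, mul_comm, coeff_C_mul]
    simp [pow_succ', coeff_one]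

open PowerSeries in
-- Each factor `1 + x + ⋯ + x ^ (r - 1)` is `(1 - x ^ r) / (1 - x)`, and the denominators together
-- form the unrestricted series.
theorem mk_blockSum_lt (y : R) (r s : ℕ) :
    PowerSeries.mk (blockSum (fun i => i < r) y s) =
      (∏ j ∈ range (s + 1), (1 - C ((y ^ r) ^ j) * X ^ r)) *
        PowerSeries.mk (blockSum (fun _ => True) y s) := by
  have h1 := mk_blockSum_eq_prod (fun i => i < r) y s
  have h2 := mk_blockSum_eq_prod (fun _ => True) y s
  have h3 : PowerSeries.mk (blockSum (fun i => i < r) y s) *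
      ∏ j ∈ range (s + 1), (1 - C (y ^ j) * X) =
      ∏ j ∈ range (s + 1), (1 - C ((y ^ r) ^ j) * X ^ r) := by
    rw [h1, ← prod_mul_distrib]
    refine prod_congr rfl fun j _ => ?_
    rw [rescale_truncated_geom_mul, pow_right_comm]
  have h4 : PowerSeries.mk (blockSum (fun _ => True) y s) *
      ∏ j ∈ range (s + 1), (1 - C (y ^ j) * X) = 1 := by
    rw [h2, ← prod_mul_distrib]
    exact prod_eq_one fun j _ => rescale_geom_mul _
  rw [← h3, mul_assoc, mul_comm (∏ j ∈ range (s + 1), (1 - C (y ^ j) * X)), h4, mul_one]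

end BlockSum

/-! ### Run sums as Gaussian binomials and as `gSum`. -/

section Identification

variable {𝕜 : Type*} [NormedField 𝕜]

theorem blockSum_true_eq_gaussBinom {y : 𝕜} (hy : ∀ n, qPochhammer y y n ≠ 0) (s l : ℕ) :
    blockSum (fun _ => True) y s l = gaussBinom y (l + s) s := by
  induction s generalizing l with
  | zero => simp [blockSum, gaussBinom_zero_right hy]
  | succ s ihs =>
    induction l with
    | zero => rw [blockSum_true_zero_right, Nat.zero_add, gaussBinom_self hy]
    | succ l ihl =>
      rw [blockSum_true_succ_succ, ihl, ihs]
      have := gaussBinom_add_succ hy s l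
      rw [show l + 1 + (s + 1) = s + l + 2 by ring, this, show l + (s + 1) = s + l + 1 by ring,
        show l + 1 + s = s + l + 1 by ring]

theorem qBinom_of_neg_lt (q : 𝕜) (k : ℕ) {A B : ℤ} (h : A < B) : qBinom q k A B = 0 := by
  simp [qBinom, not_le.mpr h]

theorem int_mul_sq_sub_div_two (n i : ℕ) :
    (n : ℤ) * ((i : ℤ) ^ 2 - i) / 2 = ((n * i.choose 2 : ℕ) : ℤ) := by
  have h : (i : ℤ) ^ 2 - i = 2 * (i.choose 2 : ℕ) := by
    induction i with
    | zero => simp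
    | succ i ih =>
      rw [Nat.choose_succ_succ' i 1, Nat.choose_one_right]
      push_cast
      linarith
  rw [h, mul_left_comm, Int.mul_ediv_cancel_left _ two_ne_zero]
  push_cast
  ring

/-- Compare coefficients of `X ^ h` in `mk_blockSum_lt`, the product being expanded by the
`q`-binomial theorem in base `q ^ (r * k)` at `X ^ r`. The argument `s + 1` is the number of runs.
-/
theorem gSum_eq_blockSum {q : 𝕜} {k r : ℕ}
    (hy : ∀ n, qPochhammer (q ^ k) (q ^ k) n ≠ 0)
    (hz : ∀ n, qPochhammer (q ^ (r * k)) (q ^ (r * k)) n ≠ 0) (s h : ℕ) :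
    gSum q k r (h : ℤ) ((s : ℤ) + 1) = blockSum (fun i => i < r) (q ^ k) s h := by
  have hzy : (q ^ k) ^ r = q ^ (r * k) := by rw [← pow_mul, mul_comm]
  have h1 := congrArg (PowerSeries.coeff h) (mk_blockSum_lt (q ^ k) r s)
  have h2 := prod_one_sub_eq_sum_gaussBinom hz ((PowerSeries.X : PowerSeries 𝕜) ^ r) (s + 1)
  simp only [PowerSeries.algebraMap_eq] at h2
  rw [hzy, h2, PowerSeries.coeff_mk] at h1
  rw [h1, sum_mul, map_sum, gSum, tsum_eq_sum (s := range (s + 1 + 1))]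
  · refine sum_congr rfl fun i _ => ?_
    rw [mul_assoc (PowerSeries.C _), PowerSeries.coeff_C_mul, ← pow_mul PowerSeries.X r i,
      PowerSeries.coeff_X_pow_mul', PowerSeries.coeff_mk]
    have e1 : (q ^ ((r : ℤ) * k * ((i : ℤ) ^ 2 - i) / 2)) = (q ^ (r * k)) ^ i.choose 2 := by
      have := int_mul_sq_sub_div_two (r * k) i
      rw [Nat.cast_mul] at this
      rw [this, zpow_natCast, pow_mul]
    rw [e1, show ((s : ℤ) + 1) = ((s + 1 : ℕ) : ℤ) by push_cast; rfl, qBinom_natCast]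
    congr 1
    split_ifs with hi
    · rw [blockSum_true_eq_gaussBinom hy, ← qBinom_natCast]
      congr 1 <;> push_cast [Nat.cast_sub hi] <;> ring
    -- For `h < r * i` the power `X ^ (r * i)` does not reach degree `h`; on the other side the
    -- upper entry `h - r * i + s` is below `s`.
    · apply qBinom_of_neg_lt
      have : (h : ℤ) < r * i := by exact_mod_cast not_le.mp hi
      push_cast
      linarith
  · intro i hi
    have hi : s + 1 < i := by simpa using hi
    rw [show ((s : ℤ) + 1) = ((s + 1 : ℕ) : ℤ) by push_cast; rfl, qBinom_natCast,
      gaussBinom_of_lt _ hi]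
    simp

end Identification

/-! ### Partitions as words with levels. -/

/-- The three residue classes. -/
inductive Letter
  | A
  | B
  | C
  deriving DecidableEq

namespace Letter

/-- The residue that a letter stands for. -/
def res (a b c : ℕ) : Letter → ℕ
  | A => a
  | B => b
  | C => c

theorem res_A (a b c : ℕ) : A.res a b c = a := rfl

theorem res_B (a b c : ℕ) : B.res a b c = b := rfl

theorem res_C (a b c : ℕ) : C.res a b c = c := rfl

/-- The letter of the residue class of `x`. -/
def of (a b k x : ℕ) : Letter :=
  if x ≡ a [MOD k] then A else if x ≡ b [MOD k] then B else C

end Letter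

open Letter

/-- Put a smallest part `k * d + X.res` in front of a nondecreasing list, after shifting that list
by the least multiple of `k` that the letter `X` requires. -/
def prependPart (a b c k : ℕ) (X : Letter) (d : ℕ) (ρ : List ℕ) : List ℕ :=
  (k * d + X.res a b c) :: ρ.map (· + k * (d + if X = C then 1 else 0))

/-- The lists of parts, in nondecreasing order, whose residues spell a given word. -/
def partsOfWord (a b c k : ℕ) : List Letter → Set (List ℕ)
  | [] => {[]}
  | X :: w => Set.range fun p : ℕ × partsOfWord a b c k w => prependPart a b c k X p.1 p.2

/-- The sum over the occurrences of `C` of the number of letters that follow. -/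
def wordStat : List Letter → ℕ
  | [] => 0
  | X :: w => wordStat w + if X = C then w.length else 0

theorem length_of_mem_partsOfWord {a b c k : ℕ} {w : List Letter} {ρ : List ℕ}
    (h : ρ ∈ partsOfWord a b c k w) : ρ.length = w.length := by
  induction w generalizing ρ with
  | nil => simp_all [partsOfWord]
  | cons X w ih =>
    obtain ⟨⟨d, ρ', hρ'⟩, rfl⟩ := h
    simp [prependPart, ih hρ']

theorem numParts_map_add (k e n : ℕ) (ρ : List ℕ) :
    numParts k e (ρ.map (· + k * n)) = numParts k e ρ := by
  simp only [numParts, List.countP_map]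
  congr 1
  ext x
  have h : x + k * n ≡ e [MOD k] ↔ x ≡ e [MOD k] := by simp [Nat.ModEq]
  simp only [Function.comp, h]

theorem sum_map_add_const (ρ : List ℕ) (n : ℕ) :
    (ρ.map (· + n)).sum = ρ.sum + n * ρ.length := by
  induction ρ with
  | nil => simp
  | cons x ρ ih => simp [ih]; ring

/-- Representatives are taken in `1, …, k` because `c = k` is allowed. -/
theorem Nat.not_modEq_of_lt_of_le {k x y : ℕ} (hx : 0 < x) (hxy : x < y) (hy : y ≤ k) :
    ¬ x ≡ y [MOD k] := by
  intro h
  have h1 := (Nat.modEq_iff_dvd' hxy.le).1 h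
  have h2 := Nat.le_of_dvd (by omega) h1
  omega

section Residues

variable {a b c k : ℕ} (ha : 1 ≤ a) (hab : a < b) (hbc : b < c) (hck : c ≤ k)

theorem prependPart_injective (hk : 0 < k) (X : Letter) :
    Function.Injective fun p : ℕ × List ℕ => prependPart a b c k X p.1 p.2 := by
  rintro ⟨d, ρ⟩ ⟨d', ρ'⟩ h
  simp only [prependPart, List.cons.injEq, Nat.add_right_cancel_iff] at h
  obtain ⟨h1, h2⟩ := h
  have hd : d = d' := Nat.eq_of_mul_eq_mul_left hk h1
  subst hd
  rw [List.map_inj_right (fun x y hxy => by simpa using hxy)] at h2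
  rw [h2]

include ha hab hbc hck

theorem res_modEq_iff (X Y : Letter) :
    X.res a b c ≡ Y.res a b c [MOD k] ↔ X = Y := by
  have h1 := Nat.not_modEq_of_lt_of_le ha hab (by omega : b ≤ k)
  have h2 := Nat.not_modEq_of_lt_of_le ha (hab.trans hbc) hck
  have h3 := Nat.not_modEq_of_lt_of_le (by omega) hbc hck
  cases X <;> cases Y <;> simp only [res_A, res_B, res_C, reduceCtorEq, iff_false, iff_true] <;>
    first | rfl | assumption | exact fun h => by simp_all [Nat.ModEq.comm]

theorem mul_add_res_modEq_iff (d : ℕ) (X Y : Letter) :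
    k * d + X.res a b c ≡ Y.res a b c [MOD k] ↔ X = Y := by
  rw [← res_modEq_iff ha hab hbc hck X Y]
  simp [Nat.ModEq]

theorem numParts_prependPart (X Y : Letter) (d : ℕ) (ρ : List ℕ) :
    numParts k (Y.res a b c) (prependPart a b c k X d ρ) =
      numParts k (Y.res a b c) ρ + if X = Y then 1 else 0 := by
  have h := numParts_map_add k (Y.res a b c) (d + if X = C then 1 else 0) ρ
  unfold numParts at h ⊢
  rw [prependPart, List.countP_cons, h]
  simp only [mul_add_res_modEq_iff ha hab hbc hck, decide_eq_true_eq]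

omit hck in
theorem res_pos (X : Letter) : 0 < X.res a b c := by
  cases X <;> simp only [res_A, res_B, res_C] <;> omega

omit ha hck in
theorem res_le (X : Letter) : X.res a b c ≤ c := by
  cases X <;> simp only [res_A, res_B, res_C] <;> omega

omit ha hck in
theorem le_res (X : Letter) : a ≤ X.res a b c := by
  cases X <;> simp only [res_A, res_B, res_C] <;> omega

theorem of_mul_add_res (d : ℕ) (X : Letter) : Letter.of a b k (k * d + X.res a b c) = X := by
  have h1 := mul_add_res_modEq_iff ha hab hbc hck d X A
  have h2 := mul_add_res_modEq_iff ha hab hbc hck d X B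
  simp only [res_A, res_B] at h1 h2
  unfold Letter.of
  rw [if_congr h1 rfl rfl, if_congr h2 rfl rfl]
  cases X <;> simp

omit ha hab hbc hck in
theorem of_add_mul (x n : ℕ) : Letter.of a b k (x + k * n) = Letter.of a b k x := by
  have h : ∀ e, x + k * n ≡ e [MOD k] ↔ x ≡ e [MOD k] := fun e => by simp [Nat.ModEq]
  simp only [Letter.of, h]

/-- A list determines its word, so different words have disjoint sets of lists. -/
theorem map_of_of_mem_partsOfWord {w : List Letter} {ρ : List ℕ}
    (h : ρ ∈ partsOfWord a b c k w) : ρ.map (Letter.of a b k) = w := by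
  induction w generalizing ρ with
  | nil => simp_all [partsOfWord]
  | cons X w ih =>
    obtain ⟨⟨d, ρ', hρ'⟩, rfl⟩ := h
    simp only [prependPart, List.map_cons, List.map_map, of_mul_add_res ha hab hbc hck,
      List.cons.injEq, true_and]
    rw [← ih hρ']
    exact List.map_congr_left fun x _ => of_add_mul x _

theorem exists_eq_mul_add_res {x : ℕ} (hx : 0 < x)
    (h : x ≡ a [MOD k] ∨ x ≡ b [MOD k] ∨ x ≡ c [MOD k]) :
    ∃ (d : ℕ) (X : Letter), x = k * d + X.res a b c := by
  have key : ∀ e, 0 < e → e ≤ k → x ≡ e [MOD k] → ∃ d, x = k * d + e := by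
    intro e he hek hxe
    have hle : e ≤ x := by
      by_contra hlt
      exact Nat.not_modEq_of_lt_of_le hx (not_le.mp hlt) hek hxe
    obtain ⟨d, hd⟩ := (Nat.modEq_iff_dvd' hle).1 hxe.symm
    exact ⟨d, by omega⟩
  rcases h with h | h | h
  · obtain ⟨d, hd⟩ := key a ha (by omega) h
    exact ⟨d, A, hd⟩
  · obtain ⟨d, hd⟩ := key b (by omega) (by omega) h
    exact ⟨d, B, hd⟩
  · obtain ⟨d, hd⟩ := key c (by omega) hck h
    exact ⟨d, C, hd⟩

end Residues

/-! ### The lists obtained from words without `BA`. -/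

/-- Nondecreasing lists of positive integers congruent to `a`, `b` or `c`, those congruent to `c`
being distinct. -/
def IsIncreasing (a b c k : ℕ) (ρ : List ℕ) : Prop :=
  ρ.Pairwise (fun x y => x ≤ y ∧ (x ≡ c [MOD k] → x ≠ y)) ∧
    ∀ x ∈ ρ, ∃ d X, x = k * d + Letter.res a b c X

/-- No letter `B` is followed by a letter `A`. -/
def NoBA (w : List Letter) : Prop :=
  w.IsChain fun X Y => ¬ (X = B ∧ Y = A)

theorem isIncreasing_map_add {a b c k : ℕ} {ρ : List ℕ} (h : IsIncreasing a b c k ρ) (n : ℕ) :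
    IsIncreasing a b c k (ρ.map (· + k * n)) := by
  obtain ⟨h1, h2⟩ := h
  refine ⟨?_, ?_⟩
  · rw [List.pairwise_map]
    refine h1.imp fun {x y} hxy => ⟨by simpa using hxy.1, fun hc => ?_⟩
    have := hxy.2 (by simpa [Nat.ModEq] using hc)
    simpa using this
  · intro x hx
    obtain ⟨y, hy, rfl⟩ := List.mem_map.1 hx
    obtain ⟨d, X, rfl⟩ := h2 y hy
    exact ⟨d + n, X, by ring⟩

section Membership

variable {a b c k : ℕ} (ha : 1 ≤ a) (hab : a < b) (hbc : b < c) (hck : c ≤ k)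
include ha hab hbc hck

theorem isIncreasing_of_mem_partsOfWord {w : List Letter} (hw : NoBA w) {ρ : List ℕ}
    (h : ρ ∈ partsOfWord a b c k w) : IsIncreasing a b c k ρ := by
  induction w generalizing ρ with
  | nil => simp_all [partsOfWord, IsIncreasing]
  | cons X w ih =>
    obtain ⟨⟨d, ρ', hρ'⟩, rfl⟩ := h
    change IsIncreasing a b c k (prependPart a b c k X d ρ')
    obtain ⟨hX, hw'⟩ := List.isChain_cons.1 hw
    have hinc := ih hw' hρ'
    have hmap := map_of_of_mem_partsOfWord ha hab hbc hck hρ'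
    -- The only use of `NoBA`: after `B` the next part is not of class `a`, so the order survives on
    -- an equal level.
    have hlow : X = B → ∀ y ∈ ρ', b ≤ y := by
      intro hXB y hy
      cases ρ' with
      | nil => simp at hy
      | cons z t =>
        have hz : b ≤ z := by
          obtain ⟨e, Y, rfl⟩ := hinc.2 z (by simp)
          have hY : Y ≠ A := by
            rintro rfl
            subst hmap
            refine hX A ?_ ⟨hXB, rfl⟩
            simp [of_mul_add_res ha hab hbc hck]
          have : b ≤ Y.res a b c := by cases Y <;> simp [res_B, res_C] at hY ⊢; omega
          omega
        rcases List.mem_cons.1 hy with rfl | hy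
        · exact hz
        · exact hz.trans ((List.pairwise_cons.1 hinc.1).1 y hy).1
    obtain ⟨h1, h2⟩ := isIncreasing_map_add hinc (d + if X = C then 1 else 0)
    refine ⟨List.pairwise_cons.2 ⟨?_, h1⟩, ?_⟩
    · intro y hy
      obtain ⟨z, hz, rfl⟩ := List.mem_map.1 hy
      obtain ⟨e, Y, hzY⟩ := hinc.2 z hz
      have hXc := mul_add_res_modEq_iff ha hab hbc hck d X C
      simp only [res_C] at hXc
      have hYa := le_res hab hbc Y
      rw [hXc]
      cases X with
      | A =>
        simp only [res_A, reduceCtorEq, if_false, false_imp_iff, and_true]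
        nlinarith [Nat.zero_le (k * e)]
      | B =>
        simp only [res_B, reduceCtorEq, if_false, false_imp_iff, and_true]
        have := hlow rfl z hz
        rw [Nat.add_zero]
        omega
      | C =>
        simp only [res_C, if_true, forall_const, mul_add, mul_one]
        have : 0 < z := by nlinarith [Nat.zero_le (k * e)]
        omega
    · intro y hy
      rcases List.mem_cons.1 hy with rfl | hy
      · exact ⟨d, X, rfl⟩
      · exact h2 y hy

theorem mem_partsOfWord_of_isIncreasing {ρ : List ℕ} (h : IsIncreasing a b c k ρ) :
    ρ ∈ partsOfWord a b c k (ρ.map (Letter.of a b k)) := by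
  induction hn : ρ.length generalizing ρ with
  | zero =>
    rw [List.length_eq_zero_iff.1 hn]
    simp [partsOfWord]
  | succ n ih =>
    cases ρ with
    | nil => simp at hn
    | cons x t =>
      obtain ⟨h1, h2⟩ := h
      obtain ⟨d, X, rfl⟩ := h2 x (by simp)
      rw [List.pairwise_cons] at h1
      -- `m` is the least level open to the later parts; lowering them all by `k * m` leaves a list
      -- to which induction applies.
      set m := d + if X = C then 1 else 0 with hm
      have hle : ∀ y ∈ t, ∃ e Y, y = k * (m + e) + Letter.res a b c Y := by
        intro y hy
        obtain ⟨f, Y, rfl⟩ := h2 y (by simp [hy])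
        have hxy := h1.1 _ hy
        have hXc := mul_add_res_modEq_iff ha hab hbc hck d X C
        simp only [res_C] at hXc
        rw [hXc] at hxy
        have hY := res_le hab hbc Y
        have hXp := res_pos ha hab hbc X
        have hdf : d ≤ f := by
          by_contra hlt
          have : k * (f + 1) ≤ k * d := Nat.mul_le_mul_left k (by omega)
          rw [mul_add] at this
          omega
        have hmf : m ≤ f := by
          rw [hm]
          split_ifs with hXC
          -- After a `C` part, a part on the same level is at most `k * d + c`, hence equal to it,
          -- against distinctness.
          · by_contra hlt
            have hfd : f = d := by omega
            have := hxy.2 hXC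
            subst hfd
            subst hXC
            simp only [res_C] at hxy this
            omega
          · exact hdf
        exact ⟨f - m, Y, by rw [Nat.add_sub_cancel' hmf]⟩
      have hback : (t.map (· - k * m)).map (· + k * m) = t := by
        rw [List.map_map]
        conv_rhs => rw [← List.map_id t]
        refine List.map_congr_left fun y hy => ?_
        obtain ⟨e, Y, rfl⟩ := hle y hy
        simp only [Function.comp, id, mul_add]
        omega
      have hinc : IsIncreasing a b c k (t.map (· - k * m)) := by
        refine ⟨?_, ?_⟩
        · have h3 := h1.2
          rw [← hback, List.pairwise_map] at h3
          refine h3.imp fun {x y} hxy => ⟨by simpa using hxy.1, fun hc => ?_⟩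
          have := hxy.2 (by simpa [Nat.ModEq] using hc)
          simpa using this
        · intro y hy
          obtain ⟨z, hz, rfl⟩ := List.mem_map.1 hy
          obtain ⟨e, Y, rfl⟩ := hle z hz
          exact ⟨e, Y, by rw [mul_add]; omega⟩
      have hmem := ih hinc (by simpa using hn)
      have hword : (t.map (· - k * m)).map (Letter.of a b k) = t.map (Letter.of a b k) := by
        conv_rhs => rw [← hback, List.map_map]
        exact List.map_congr_left fun y _ => (of_add_mul y m).symm
      rw [hword] at hmem
      rw [List.map_cons, of_mul_add_res ha hab hbc hck]
      refine ⟨(d, ⟨_, hmem⟩), ?_⟩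
      simp only [prependPart]
      rw [← hm, hback]

end Membership

/-! ### The generating function of one word. -/

theorem hasSum_range_of_eq_geometric_mul {𝕜 β γ : Type*} [NormedField 𝕜] [CompleteSpace 𝕜]
    {g : ℕ × γ → β} (hg : Function.Injective g) {f : β → 𝕜} {u : γ → 𝕜} {x L U : 𝕜}
    (hx : ‖x‖ < 1) (hu : Summable fun i => ‖u i‖) (hU : HasSum u U)
    (hf : ∀ p, f (g p) = L * (x ^ p.1 * u p.2)) :
    Summable (fun y : Set.range g => ‖f y‖) ∧
      HasSum (fun y : Set.range g => f y) (L * ((1 - x)⁻¹ * U)) := by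
  have hgeom := hasSum_geometric_of_norm_lt_one hx
  have hgeomn : Summable fun d : ℕ => ‖x ^ d‖ := by
    simpa only [norm_pow] using summable_geometric_of_norm_lt_one (x := ‖x‖) (by simpa using hx)
  have hmul : Summable fun p : ℕ × γ => ‖x ^ p.1 * u p.2‖ := Summable.mul_norm hgeomn hu
  constructor
  · have h : Summable fun p : ℕ × γ => ‖f (g p)‖ :=
      (hmul.mul_left ‖L‖).congr fun p => ((congrArg norm (hf p)).trans (norm_mul _ _)).symm
    exact ((hg.hasSum_range_iff (f := fun y => ‖f y‖)).2 h.hasSum).summable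
  · have h : HasSum (fun p : ℕ × γ => f (g p)) (L * ((1 - x)⁻¹ * U)) := by
      simpa only [hf] using (hgeom.mul hU hmul.of_norm).mul_left L
    exact (hg.hasSum_range_iff (f := f)).2 h

section Weights

variable {𝕜 : Type*} [NormedField 𝕜] {a b c k : ℕ}

/-- The sum of the weights of the lists of parts that belong to a word. -/
def wordWeight (μ ν ω q : 𝕜) (a b c k : ℕ) (w : List Letter) : 𝕜 :=
  (μ * q ^ a) ^ w.count A * (ν * q ^ b) ^ w.count B * (ω * q ^ c) ^ w.count C *
    (q ^ k) ^ wordStat w / qPochhammer (q ^ k) (q ^ k) w.length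

/-- The weight of a single letter. -/
def letterWeight (μ ν ω q : 𝕜) (a b c : ℕ) : Letter → 𝕜
  | A => μ * q ^ a
  | B => ν * q ^ b
  | C => ω * q ^ c

theorem wordWeight_cons (μ ν ω q : 𝕜) (X : Letter) (w : List Letter) :
    wordWeight μ ν ω q a b c k (X :: w) =
      letterWeight μ ν ω q a b c X * (q ^ k) ^ (if X = C then w.length else 0) *
        (1 - (q ^ k) ^ (w.length + 1))⁻¹ * wordWeight μ ν ω q a b c k w := by
  simp only [wordWeight, List.length_cons, qPochhammer_succ, wordStat]
  cases X <;> simp [letterWeight, pow_add, div_eq_mul_inv] <;> ring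

theorem norm_partWeight (μ ν ω q : 𝕜) (π : List ℕ) :
    ‖partWeight μ ν ω q a b c k π‖ = partWeight ‖μ‖ ‖ν‖ ‖ω‖ ‖q‖ a b c k π := by
  simp [partWeight]

section

variable (ha : 1 ≤ a) (hab : a < b) (hbc : b < c) (hck : c ≤ k)
include ha hab hbc hck

/-- The level `d` lifts all `ρ.length + 1` parts; a letter `C` lifts the later `ρ.length` parts once
more. -/
theorem partWeight_prependPart (μ ν ω q : 𝕜) (X : Letter) (d : ℕ) (ρ : List ℕ) :
    partWeight μ ν ω q a b c k (prependPart a b c k X d ρ) =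
      letterWeight μ ν ω q a b c X * (q ^ k) ^ (if X = C then ρ.length else 0) *
        (((q ^ k) ^ (ρ.length + 1)) ^ d * partWeight μ ν ω q a b c k ρ) := by
  have hA := numParts_prependPart ha hab hbc hck X A d ρ
  have hB := numParts_prependPart ha hab hbc hck X B d ρ
  have hC := numParts_prependPart ha hab hbc hck X C d ρ
  simp only [res_A, res_B, res_C] at hA hB hC
  simp only [partWeight, hA, hB, hC]
  have hs : (prependPart a b c k X d ρ).sum =
      X.res a b c + k * (if X = C then ρ.length else 0) + k * (ρ.length + 1) * d + ρ.sum := by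
    rw [prependPart, List.sum_cons, sum_map_add_const]
    split_ifs <;> ring
  rw [hs]
  simp only [← pow_mul, pow_add]
  cases X <;> simp [letterWeight, res_A, res_B, res_C] <;> ring

/-- Each letter brings a geometric series in its level. Absolute summability is part of the
induction because it justifies the product of series. -/
theorem hasSum_partsOfWord [CompleteSpace 𝕜] (μ ν ω : 𝕜) {q : 𝕜} (hq : ‖q‖ < 1)
    (w : List Letter) :
    Summable (fun ρ : partsOfWord a b c k w => ‖partWeight μ ν ω q a b c k (ρ : List ℕ)‖) ∧
    HasSum (fun ρ : partsOfWord a b c k w => partWeight μ ν ω q a b c k (ρ : List ℕ))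
      (wordWeight μ ν ω q a b c k w) := by
  have hk : 0 < k := by omega
  induction w with
  | nil =>
    have e : wordWeight μ ν ω q a b c k [] = partWeight μ ν ω q a b c k [] := by
      simp [wordWeight, partWeight, wordStat, qPochhammer, numParts]
    rw [e]
    let : Unique (partsOfWord a b c k []) := Set.uniqueSingleton []
    exact ⟨Summable.of_finite, hasSum_unique
      (fun ρ : partsOfWord a b c k [] => partWeight μ ν ω q a b c k (ρ : List ℕ))⟩
  | cons X w ih =>
    obtain ⟨ih1, ih2⟩ := ih
    have hinj : Function.Injective fun p : ℕ × partsOfWord a b c k w =>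
        prependPart a b c k X p.1 p.2 := by
      rintro ⟨d, ρ⟩ ⟨d', ρ'⟩ h
      have := prependPart_injective hk X (a₁ := (d, (ρ : List ℕ))) (a₂ := (d', (ρ' : List ℕ))) h
      simpa [Subtype.ext_iff] using this
    have hpow : ‖(q ^ k) ^ (w.length + 1)‖ < 1 := by
      rw [← pow_mul, norm_pow]
      exact pow_lt_one₀ (norm_nonneg _) hq (by positivity)
    rw [wordWeight_cons, mul_assoc _ (_⁻¹)]
    refine hasSum_range_of_eq_geometric_mul hinj hpow ih1 ih2 fun p => ?_
    rw [partWeight_prependPart ha hab hbc hck, length_of_mem_partsOfWord p.2.2]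

end

end Weights

/-! ### Words cut at their letters `C`. -/

/-- The word `A ⋯ A B ⋯ B` followed by `t`. -/
def blockThen (l h : ℕ) (t : List Letter) : List Letter :=
  List.replicate l A ++ (List.replicate h B ++ t)

theorem blockThen_succ (l h : ℕ) (t : List Letter) :
    blockThen (l + 1) h t = A :: blockThen l h t := rfl

theorem blockThen_zero_succ (h : ℕ) (t : List Letter) :
    blockThen 0 (h + 1) t = B :: blockThen 0 h t := rfl

theorem blockThen_injective {l h l' h' : ℕ} {w w' : List Letter}
    (e : blockThen l h (C :: w) = blockThen l' h' (C :: w')) : l = l' ∧ h = h' ∧ w = w' := by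
  induction l generalizing l' with
  | zero =>
    cases l' with
    | zero =>
      induction h generalizing h' with
      | zero =>
        cases h' with
        | zero => simpa [blockThen] using e
        | succ h' => simp [blockThen, List.replicate_succ] at e
      | succ h ih =>
        cases h' with
        | zero => simp [blockThen, List.replicate_succ] at e
        | succ h' =>
          rw [blockThen_zero_succ, blockThen_zero_succ, List.cons.injEq] at e
          simpa using ih e.2
    | succ l' => cases h <;> simp [blockThen, List.replicate_succ] at e
  | succ l ih =>
    cases l' with
    | zero => cases h' <;> simp [blockThen, List.replicate_succ] at e
    | succ l' =>
      rw [blockThen_succ, blockThen_succ, List.cons.injEq] at e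
      simpa using ih e.2

theorem exists_eq_blockThen {w : List Letter} (hw : NoBA w) :
    ∃ l h t, w = blockThen l h t ∧ (t = [] ∨ ∃ w', t = C :: w') := by
  induction w with
  | nil => exact ⟨0, 0, [], rfl, Or.inl rfl⟩
  | cons X w ih =>
    obtain ⟨hX, hw'⟩ := List.isChain_cons.1 hw
    obtain ⟨l, h, t, rfl, ht⟩ := ih hw'
    cases X with
    | A => exact ⟨l + 1, h, t, rfl, ht⟩
    | B =>
      cases l with
      | zero => exact ⟨0, h + 1, t, rfl, ht⟩
      | succ l => exact absurd ⟨rfl, rfl⟩ (hX A (by simp [blockThen_succ]))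
    | C => exact ⟨0, 0, _, rfl, Or.inr ⟨_, rfl⟩⟩

section Valid

variable (H : ℕ → Prop)

/-- The words without a factor `BA` in which the length of every run of letters `B`
satisfies `H`. -/
def ValidWord (w : List Letter) : Prop :=
  NoBA w ∧ ∀ i, List.replicate i B <:+: w → H i

variable {H}

theorem validWord_cons_of_ne_B {X : Letter} (hX : X ≠ B) (w : List Letter) :
    ValidWord H (X :: w) ↔ ValidWord H w := by
  unfold ValidWord NoBA
  rw [List.isChain_cons]
  refine and_congr (by simp [hX]) (forall_congr' fun i => ?_)
  rw [List.infix_cons_iff]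
  cases i with
  | zero => simp
  | succ i => simp [List.replicate_succ, hX.symm]

theorem validWord_blockThen (l h : ℕ) (t : List Letter) :
    ValidWord H (blockThen l h t) ↔ ValidWord H (List.replicate h B ++ t) := by
  induction l with
  | zero => rfl
  | succ l ih => rw [blockThen_succ, validWord_cons_of_ne_B (by decide), ih]

theorem replicate_prefix_iff {t : List Letter} (ht : t = [] ∨ ∃ w', t = C :: w') (i h : ℕ) :
    List.replicate i B <+: List.replicate h B ++ t ↔ i ≤ h := by
  induction i generalizing h with
  | zero => simp
  | succ i ih =>
    cases h with
    | zero => rcases ht with rfl | ⟨w', rfl⟩ <;> simp [List.replicate_succ]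
    | succ h => simp [List.replicate_succ, ih]

/-- As `t` does not begin with `B`, a run of `B` lies in the leading run or in `t`; `hH` covers the
shorter pieces of the leading run. -/
theorem validWord_replicate_append (hH : ∀ i j, i ≤ j → H j → H i) {t : List Letter}
    (ht : t = [] ∨ ∃ w', t = C :: w') (h : ℕ) :
    ValidWord H (List.replicate h B ++ t) ↔ H h ∧ ValidWord H t := by
  induction h with
  | zero =>
    simp only [List.replicate_zero, List.nil_append, iff_and_self]
    exact fun h => h.2 0 (by simp)
  | succ h ih =>
    have hchain : NoBA (List.replicate (h + 1) B ++ t) ↔ NoBA (List.replicate h B ++ t) := by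
      unfold NoBA
      rw [List.replicate_succ, List.cons_append, List.isChain_cons]
      refine and_iff_right ?_
      rintro y hy ⟨-, rfl⟩
      rcases ht with rfl | ⟨w', rfl⟩ <;> cases h <;> simp [List.replicate_succ] at hy
    have hrun : (∀ i, List.replicate i B <:+: List.replicate (h + 1) B ++ t → H i) ↔
        H (h + 1) ∧ ∀ i, List.replicate i B <:+: List.replicate h B ++ t → H i := by
      constructor
      · intro H1
        refine ⟨H1 _ ⟨[], t, by simp⟩, fun i hi => H1 i ?_⟩
        rw [List.replicate_succ, List.cons_append, List.infix_cons_iff]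
        exact Or.inr hi
      · rintro ⟨h1, h2⟩ i hi
        rw [List.replicate_succ, List.cons_append, List.infix_cons_iff, ← List.cons_append,
          ← List.replicate_succ, replicate_prefix_iff ht] at hi
        rcases hi with hi | hi
        · exact hH _ _ hi h1
        · exact h2 i hi
    have hHh : H (h + 1) → H h := hH _ _ (Nat.le_succ h)
    unfold ValidWord at ih ⊢
    rw [hchain, hrun]
    tauto

theorem validWord_nil_iff : ValidWord H [] ↔ H 0 := by
  simp [ValidWord, NoBA]

theorem validWord_blockThen_nil (hH : ∀ i j, i ≤ j → H j → H i) (l h : ℕ) :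
    ValidWord H (blockThen l h []) ↔ H h := by
  rw [validWord_blockThen, validWord_replicate_append hH (Or.inl rfl), validWord_nil_iff,
    and_iff_left_iff_imp]
  exact hH _ _ (Nat.zero_le h)

theorem validWord_blockThen_cons (hH : ∀ i j, i ≤ j → H j → H i) (l h : ℕ) (w : List Letter) :
    ValidWord H (blockThen l h (C :: w)) ↔ H h ∧ ValidWord H w := by
  rw [validWord_blockThen, validWord_replicate_append hH (Or.inr ⟨w, rfl⟩),
    validWord_cons_of_ne_B (by decide)]

variable (H) [DecidablePred H]

/-- The valid words with `s` letters `C`, `l` letters `A` and `h` letters `B`. -/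
def validWords : ℕ → ℕ → ℕ → Finset (List Letter)
  | 0, l, h => if H h then {blockThen l h []} else ∅
  | s + 1, l, h => (antidiagonal l ×ˢ antidiagonal h).biUnion fun p =>
      if H p.2.1 then
        (validWords s p.1.2 p.2.2).image fun w => blockThen p.1.1 p.2.1 (C :: w)
      else ∅

variable {H}

theorem count_blockThen (X : Letter) (l h : ℕ) (t : List Letter) :
    (blockThen l h t).count X =
      (if X = A then l else 0) + (if X = B then h else 0) + t.count X := by
  cases X <;> simp [blockThen, List.count_append, List.count_replicate]

theorem mem_validWords (hH : ∀ i j, i ≤ j → H j → H i) {s l h : ℕ} {w : List Letter} :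
    w ∈ validWords H s l h ↔
      ValidWord H w ∧ w.count C = s ∧ w.count A = l ∧ w.count B = h := by
  induction s generalizing l h w with
  | zero =>
    constructor
    · intro hw
      by_cases hh : H h
      · simp only [validWords, hh, if_true, mem_singleton] at hw
        subst hw
        exact ⟨(validWord_blockThen_nil hH l h).2 hh, by simp [count_blockThen]⟩
      · simp [validWords, hh] at hw
    · rintro ⟨h1, h2, rfl, rfl⟩
      obtain ⟨l, h, t, rfl, rfl | ⟨w', rfl⟩⟩ := exists_eq_blockThen h1.1
      · rw [validWord_blockThen_nil hH] at h1
        simp [validWords, count_blockThen, h1]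
      · simp [count_blockThen] at h2
  | succ s ih =>
    simp only [validWords, mem_biUnion, mem_product, HasAntidiagonal.mem_antidiagonal]
    constructor
    · rintro ⟨⟨⟨l1, l2⟩, ⟨h1, h2⟩⟩, ⟨rfl, rfl⟩, hw⟩
      split_ifs at hw with hh
      · obtain ⟨w', hw', rfl⟩ := mem_image.1 hw
        obtain ⟨i1, i2, i3, i4⟩ := ih.1 hw'
        refine ⟨(validWord_blockThen_cons hH _ _ _).2 ⟨hh, i1⟩, ?_⟩
        simp [count_blockThen, i2, i3, i4]
      · simp at hw
    · rintro ⟨h1, h2, rfl, rfl⟩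
      obtain ⟨l, h, t, rfl, rfl | ⟨w', rfl⟩⟩ := exists_eq_blockThen h1.1
      · simp [count_blockThen] at h2
      · rw [validWord_blockThen_cons hH] at h1
        refine ⟨((l, w'.count A), (h, w'.count B)), by simp [count_blockThen], ?_⟩
        simp only [h1.1, if_true]
        refine mem_image_of_mem _ (ih.2 ⟨h1.2, ?_, rfl, rfl⟩)
        simpa [count_blockThen] using h2

theorem wordStat_blockThen (l h : ℕ) (t : List Letter) :
    wordStat (blockThen l h t) = wordStat t := by
  induction l with
  | zero =>
    induction h with
    | zero => rfl
    | succ h ih => simpa [blockThen_zero_succ, wordStat] using ih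
  | succ l ih => simpa [blockThen_succ, wordStat] using ih

theorem length_eq_count (w : List Letter) : w.length = w.count C + w.count A + w.count B := by
  induction w with
  | nil => simp
  | cons X w ih => cases X <;> simp [ih] <;> ring

theorem sum_validWords (hH : ∀ i j, i ≤ j → H j → H i) {R : Type*} [CommRing R] (y : R)
    (s l h : ℕ) :
    ∑ w ∈ validWords H s l h, y ^ wordStat w =
      y ^ s.choose 2 * blockSum (fun _ => True) y s l * blockSum H y s h := by
  induction s generalizing l h with
  | zero =>
    by_cases hh : H h
    · simp [validWords, blockSum, hh, wordStat_blockThen, wordStat]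
    · simp [validWords, blockSum, hh]
  | succ s ih =>
    rw [validWords, sum_biUnion]
    · have key : ∀ p ∈ antidiagonal l ×ˢ antidiagonal h,
          ∑ w ∈ (if H p.2.1 then
            (validWords H s p.1.2 p.2.2).image fun w => blockThen p.1.1 p.2.1 (C :: w)
            else ∅), y ^ wordStat w =
          y ^ (s + 1).choose 2 * ((y ^ p.1.2 * blockSum (fun _ => True) y s p.1.2) *
            ((if H p.2.1 then 1 else 0) * (y ^ p.2.2 * blockSum H y s p.2.2))) := by
        rintro ⟨⟨l1, l2⟩, ⟨h1, h2⟩⟩ -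
        dsimp only
        split_ifs with hh
        · rw [sum_image fun w _ w' _ e => (blockThen_injective e).2.2]
          -- The first `C` precedes `s + l2 + h2` letters: `y ^ s` raises `s.choose 2` to `(s +
          -- 1).choose 2`, the rest feeds the two recursions of `blockSum`.
          have : ∀ w ∈ validWords H s l2 h2, y ^ wordStat (blockThen l1 h1 (C :: w)) =
              y ^ (s + l2 + h2) * y ^ wordStat w := by
            intro w hw
            obtain ⟨-, i2, i3, i4⟩ := (mem_validWords hH).1 hw
            rw [wordStat_blockThen, wordStat, if_pos rfl, length_eq_count, i2, i3, i4]
            ring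
          rw [sum_congr rfl this, ← mul_sum, ih, Nat.choose_succ_succ' s 1, Nat.choose_one_right]
          ring
        · simp
      rw [sum_congr rfl key, ← mul_sum, sum_product]
      simp only [blockSum, if_true, one_mul]
      rw [mul_assoc, sum_mul_sum]
    · rintro ⟨⟨l1, l2⟩, ⟨h1, h2⟩⟩ - ⟨⟨l1', l2'⟩, ⟨h1', h2'⟩⟩ - hne
      rw [Function.onFun, Finset.disjoint_left]
      intro w hw hw'
      dsimp only at hw hw'
      split_ifs at hw hw'
      · obtain ⟨v, hv, rfl⟩ := mem_image.1 hw
        obtain ⟨v', hv', e⟩ := mem_image.1 hw'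
        obtain ⟨rfl, rfl, rfl⟩ := blockThen_injective e
        obtain ⟨-, -, i3, i4⟩ := (mem_validWords hH).1 hv
        obtain ⟨-, -, j3, j4⟩ := (mem_validWords hH).1 hv'
        exact hne (by rw [← i3, ← i4, ← j3, ← j4])
      all_goals simp at hw hw'

end Valid

/-! ### Summation over lists with given numbers of parts in each class. -/

section Fibers

variable {𝕜 : Type*} [NormedField 𝕜] {a b c k : ℕ} (H : ℕ → Prop) [DecidablePred H]

/-- The sum of the weights of the lists of parts with `s`, `l` and `h` parts in the
three classes. -/
def countTerm (μ ν ω q : 𝕜) (a b c k s l h : ℕ) : 𝕜 :=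
  (μ * q ^ a) ^ l * (ν * q ^ b) ^ h * (ω * q ^ c) ^ s * (q ^ k) ^ s.choose 2 *
    blockSum (fun _ => True) (q ^ k) s l * blockSum H (q ^ k) s h /
      qPochhammer (q ^ k) (q ^ k) (s + l + h)

/-- The lists of parts that belong to a valid word with prescribed letter counts. -/
def partsOfCounts (a b c k s l h : ℕ) : Set (List ℕ) :=
  ⋃ w ∈ validWords H s l h, partsOfWord a b c k w

variable {H}

theorem sum_wordWeight (hH : ∀ i j, i ≤ j → H j → H i) (μ ν ω q : 𝕜) (s l h : ℕ) :
    ∑ w ∈ validWords H s l h, wordWeight μ ν ω q a b c k w =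
      countTerm H μ ν ω q a b c k s l h := by
  have : ∀ w ∈ validWords H s l h, wordWeight μ ν ω q a b c k w =
      (μ * q ^ a) ^ l * (ν * q ^ b) ^ h * (ω * q ^ c) ^ s /
        qPochhammer (q ^ k) (q ^ k) (s + l + h) * (q ^ k) ^ wordStat w := by
    intro w hw
    obtain ⟨-, i2, i3, i4⟩ := (mem_validWords hH).1 hw
    rw [wordWeight, length_eq_count, i2, i3, i4]
    ring
  rw [sum_congr rfl this, ← mul_sum, sum_validWords hH, countTerm]
  ring

variable (ha : 1 ≤ a) (hab : a < b) (hbc : b < c) (hck : c ≤ k)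
include ha hab hbc hck

theorem hasSum_partsOfCounts [CompleteSpace 𝕜] (hH : ∀ i j, i ≤ j → H j → H i)
    (μ ν ω : 𝕜) {q : 𝕜} (hq : ‖q‖ < 1) (s l h : ℕ) :
    HasSum (fun ρ : partsOfCounts H a b c k s l h => partWeight μ ν ω q a b c k (ρ : List ℕ))
      (countTerm H μ ν ω q a b c k s l h) := by
  rw [← sum_wordWeight hH]
  have hsum := fun w => (hasSum_partsOfWord ha hab hbc hck μ ν ω hq w).2
  refine hasSum_sum_disjoint (f := partWeight μ ν ω q a b c k) (t := partsOfWord a b c k)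
    (a := wordWeight μ ν ω q a b c k) (validWords H s l h) ?_ fun w _ => hsum w
  intro w _ w' _ hne
  rw [Function.onFun, Set.disjoint_left]
  intro ρ h1 h2
  exact hne ((map_of_of_mem_partsOfWord ha hab hbc hck h1).symm.trans
    (map_of_of_mem_partsOfWord ha hab hbc hck h2))

theorem pairwise_disjoint_partsOfCounts (hH : ∀ i j, i ≤ j → H j → H i) :
    Pairwise (Function.onFun Disjoint fun p : ℕ × ℕ × ℕ =>
      partsOfCounts H a b c k p.1 p.2.1 p.2.2) := by
  rintro ⟨s, l, h⟩ ⟨s', l', h'⟩ hne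
  rw [Function.onFun, Set.disjoint_left]
  intro ρ h1 h2
  simp only [partsOfCounts, Set.mem_iUnion] at h1 h2
  obtain ⟨w, hw, h1⟩ := h1
  obtain ⟨w', hw', h2⟩ := h2
  have e := (map_of_of_mem_partsOfWord ha hab hbc hck h1).symm.trans
    (map_of_of_mem_partsOfWord ha hab hbc hck h2)
  subst e
  obtain ⟨-, i2, i3, i4⟩ := (mem_validWords hH).1 hw
  obtain ⟨-, j2, j3, j4⟩ := (mem_validWords hH).1 hw'
  exact hne (by rw [← i2, ← i3, ← i4, ← j2, ← j3, ← j4])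

theorem mem_iUnion_partsOfCounts_iff (hH : ∀ i j, i ≤ j → H j → H i) (ρ : List ℕ) :
    ρ ∈ ⋃ p : ℕ × ℕ × ℕ, partsOfCounts H a b c k p.1 p.2.1 p.2.2 ↔
      IsIncreasing a b c k ρ ∧ ValidWord H (ρ.map (Letter.of a b k)) := by
  simp only [partsOfCounts, Set.mem_iUnion]
  constructor
  · rintro ⟨p, w, hw, h⟩
    have hv := ((mem_validWords hH).1 hw).1
    refine ⟨isIncreasing_of_mem_partsOfWord ha hab hbc hck hv.1 h, ?_⟩
    rwa [map_of_of_mem_partsOfWord ha hab hbc hck h]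
  · rintro ⟨h1, h2⟩
    exact ⟨(_, _, _), _, (mem_validWords hH).2 ⟨h2, rfl, rfl, rfl⟩,
      mem_partsOfWord_of_isIncreasing ha hab hbc hck h1⟩

end Fibers

/-- Summable fibre sums of norms give absolute convergence on the union, which permits summation by
fibres. -/
theorem hasSum_iUnion_of_norm {𝕜 β ι : Type*} [NormedField 𝕜] [CompleteSpace 𝕜]
    {T : ι → Set β} (hT : Pairwise (Function.onFun Disjoint T)) {f : β → 𝕜} {F : ι → 𝕜}
    {N : ι → ℝ} (hN : ∀ i, HasSum (fun x : T i => ‖f x‖) (N i)) (hNs : Summable N)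
    (hF : ∀ i, HasSum (fun x : T i => f x) (F i)) :
    ∃ Z, HasSum F Z ∧ HasSum (fun x : (⋃ i, T i : Set β) => f x) Z := by
  let e := (Set.unionEqSigmaOfDisjoint hT).symm
  have he : ∀ x : Σ i, T i, (e x : β) = x.2 := fun _ => rfl
  have hs : Summable fun x : Σ i, T i => f x.2 := by
    refine Summable.of_norm ?_
    rw [summable_sigma_of_nonneg fun x => norm_nonneg _]
    refine ⟨fun i => (hN i).summable, hNs.congr fun i => (hN i).tsum_eq.symm⟩
  refine ⟨∑' x : Σ i, T i, f x.2, hs.hasSum.sigma hF, ?_⟩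
  rw [← e.hasSum_iff]
  exact hs.hasSum

/-! ### Convergence for nonnegative real parameters. -/

section RealBounds

theorem inv_qPochhammer_le {y : ℝ} (hy0 : 0 ≤ y) (hy1 : y < 1) (n : ℕ) :
    0 < qPochhammer y y n ∧
      1 / qPochhammer y y n ≤ Real.exp ((∑ i ∈ range n, y ^ i) * (1 - y)⁻¹) := by
  induction n with
  | zero => simp [qPochhammer]
  | succ n ih =>
    obtain ⟨ih1, ih2⟩ := ih
    have h1y : 0 < 1 - y := by linarith
    have hle : y ^ (n + 1) ≤ y := pow_le_of_le_one hy0 hy1.le (by omega)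
    have hle' : y ^ (n + 1) ≤ y ^ n := pow_le_pow_of_le_one hy0 hy1.le (by omega)
    have hpos : 0 < 1 - y ^ (n + 1) := by linarith
    rw [qPochhammer_succ]
    refine ⟨mul_pos ih1 hpos, ?_⟩
    rw [← div_div, div_eq_mul_inv (1 / _), sum_range_succ, add_mul, Real.exp_add]
    refine mul_le_mul ih2 ?_ (inv_nonneg.2 hpos.le) (Real.exp_pos _).le
    calc (1 - y ^ (n + 1))⁻¹ = y ^ (n + 1) * (1 - y ^ (n + 1))⁻¹ + 1 := by
          field_simp
          ring
      _ ≤ y ^ n * (1 - y)⁻¹ + 1 := by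
          have : (1 - y ^ (n + 1))⁻¹ ≤ (1 - y)⁻¹ := inv_anti₀ h1y (by linarith)
          gcongr
      _ ≤ _ := Real.add_one_le_exp _

theorem geom_sum_le_inv {y : ℝ} (hy0 : 0 ≤ y) (hy1 : y < 1) (n : ℕ) :
    ∑ i ∈ range n, y ^ i ≤ (1 - y)⁻¹ :=
  sum_le_hasSum _ (fun _ _ => pow_nonneg hy0 _) (hasSum_geometric_of_lt_one hy0 hy1)

theorem summable_pow_mul_pow_choose_two {y γ : ℝ} (hy0 : 0 ≤ y) (hy1 : y < 1) (hγ : 0 ≤ γ) :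
    Summable fun s : ℕ => γ ^ s * y ^ s.choose 2 := by
  have hlim : Filter.Tendsto (fun s : ℕ => γ * y ^ s) Filter.atTop (nhds 0) := by
    simpa using (tendsto_pow_atTop_nhds_zero_of_lt_one hy0 hy1).const_mul γ
  refine summable_of_ratio_norm_eventually_le (r := 1 / 2) (by norm_num) ?_
  filter_upwards [hlim.eventually_le_const (show (0 : ℝ) < 1 / 2 by norm_num)] with s hs
  have h0 : ∀ s : ℕ, 0 ≤ γ ^ s * y ^ s.choose 2 := fun s => by positivity
  rw [Real.norm_of_nonneg (h0 _), Real.norm_of_nonneg (h0 _), Nat.choose_succ_succ' s 1,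
    Nat.choose_one_right]
  calc γ ^ (s + 1) * y ^ (s + s.choose 2) = (γ * y ^ s) * (γ ^ s * y ^ s.choose 2) := by ring
    _ ≤ _ := mul_le_mul_of_nonneg_right hs (h0 s)

variable {H : ℕ → Prop} [DecidablePred H]

theorem blockSum_nonneg {y : ℝ} (hy0 : 0 ≤ y) (s h : ℕ) : 0 ≤ blockSum H y s h := by
  induction s generalizing h with
  | zero => simp only [blockSum]; split_ifs <;> norm_num
  | succ s ih =>
    refine sum_nonneg fun p _ => mul_nonneg ?_ (mul_nonneg (pow_nonneg hy0 _) (ih _))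
    split_ifs <;> norm_num

/-- The sum is a product over runs. The first factor is at most `1 + N ≤ exp N`, and replacing `β`
by `β * y` shrinks the tail bound to `y * N`. As the geometric sums stay below `(1 - y)⁻¹`, the
bound becomes uniform in `s`. -/
theorem summable_pow_mul_blockSum {y : ℝ} (hy0 : 0 ≤ y) (hy1 : y < 1) {β N : ℝ} (hβ : 0 ≤ β)
    (hs : Summable fun h : ℕ => if H (h + 1) then β ^ (h + 1) else 0)
    (hN : ∑' h : ℕ, (if H (h + 1) then β ^ (h + 1) else 0) ≤ N) (s : ℕ) :
    Summable (fun h => β ^ h * blockSum H y s h) ∧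
      ∑' h, β ^ h * blockSum H y s h ≤ Real.exp (N * ∑ j ∈ range (s + 1), y ^ j) := by
  have hfirst : ∀ {β N : ℝ}, 0 ≤ β →
      (Summable fun h : ℕ => if H (h + 1) then β ^ (h + 1) else 0) →
      ∑' h : ℕ, (if H (h + 1) then β ^ (h + 1) else 0) ≤ N →
      Summable (fun h : ℕ => if H h then β ^ h else 0) ∧
        ∑' h : ℕ, (if H h then β ^ h else 0) ≤ Real.exp N := by
    intro β N hβ hs hN
    have h1 : Summable (fun h : ℕ => if H h then β ^ h else 0) :=
      (summable_nat_add_iff (f := fun h : ℕ => if H h then β ^ h else 0) 1).1 hs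
    refine ⟨h1, ?_⟩
    rw [h1.tsum_eq_zero_add]
    have h2 : (if H 0 then β ^ 0 else 0) ≤ 1 := by split_ifs <;> norm_num
    linarith [Real.add_one_le_exp N]
  induction s generalizing β N with
  | zero =>
    have := hfirst hβ hs hN
    simpa [blockSum] using this
  | succ s ih =>
    obtain ⟨f1, f2⟩ := hfirst hβ hs hN
    have hterm : ∀ h : ℕ, (if H (h + 1) then (β * y) ^ (h + 1) else 0) ≤
        y * (if H (h + 1) then β ^ (h + 1) else 0) := by
      intro h
      split_ifs
      · rw [mul_pow, mul_comm y]
        exact mul_le_mul_of_nonneg_left (pow_le_of_le_one hy0 hy1.le (by omega)) (by positivity)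
      · simp
    have hs' : Summable fun h : ℕ => if H (h + 1) then (β * y) ^ (h + 1) else 0 :=
      Summable.of_nonneg_of_le (fun h => by split_ifs <;> positivity) hterm (hs.mul_left y)
    have hN' : ∑' h : ℕ, (if H (h + 1) then (β * y) ^ (h + 1) else 0) ≤ y * N := by
      refine (hs'.tsum_le_tsum hterm (hs.mul_left y)).trans ?_
      rw [tsum_mul_left]
      exact mul_le_mul_of_nonneg_left hN hy0
    obtain ⟨g1, g2⟩ := ih (mul_nonneg hβ hy0) hs' hN'
    have hconv : (fun h => β ^ h * blockSum H y (s + 1) h) = fun h =>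
        ∑ p ∈ antidiagonal h, (if H p.1 then β ^ p.1 else 0) *
          ((β * y) ^ p.2 * blockSum H y s p.2) := by
      ext h
      rw [blockSum, mul_sum]
      refine sum_congr rfl fun p hp => ?_
      rw [← HasAntidiagonal.mem_antidiagonal.1 hp]
      split_ifs <;> ring
    have g0 : ∀ h, 0 ≤ (β * y) ^ h * blockSum H y s h := fun h =>
      mul_nonneg (by positivity) (blockSum_nonneg hy0 s h)
    rw [hconv, ← tsum_mul_tsum_eq_tsum_sum_antidiagonal_of_summable_norm f1.norm g1.norm]
    refine ⟨(summable_norm_sum_mul_antidiagonal_of_summable_norm f1.norm g1.norm).of_norm, ?_⟩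
    rw [sum_range_succ' _ (s + 1), pow_zero, mul_add, mul_one, add_comm, Real.exp_add]
    refine mul_le_mul f2 (g2.trans_eq ?_) (tsum_nonneg g0) (Real.exp_pos _).le
    simp only [pow_succ', ← mul_sum]
    congr 1
    ring

theorem summable_mul_mul_of_tsum_le {u : ℕ → ℝ} {f g : ℕ → ℕ → ℝ} {D E : ℝ} (hu : Summable u)
    (hu0 : ∀ s, 0 ≤ u s) (hf0 : ∀ s l, 0 ≤ f s l) (hg0 : ∀ s h, 0 ≤ g s h)
    (hf : ∀ s, Summable (f s)) (hg : ∀ s, Summable (g s))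
    (hD : ∀ s, ∑' l, f s l ≤ D) (hE : ∀ s, ∑' h, g s h ≤ E) :
    Summable fun p : ℕ × ℕ × ℕ => u p.1 * (f p.1 p.2.1 * g p.1 p.2.2) := by
  have hprod : ∀ s, Summable fun p : ℕ × ℕ => f s p.1 * g s p.2 := fun s =>
    Summable.mul_of_nonneg (f := f s) (g := g s) (hf s) (hg s) (hf0 s) (hg0 s)
  let F : ℕ × ℕ × ℕ → ℝ := fun p => u p.1 * (f p.1 p.2.1 * g p.1 p.2.2)
  have hnn : 0 ≤ F := fun p => mul_nonneg (hu0 _) (mul_nonneg (hf0 _ _) (hg0 _ _))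
  refine (summable_prod_of_nonneg hnn).2 ⟨fun s => (hprod s).mul_left (u s), ?_⟩
  refine Summable.of_nonneg_of_le (fun s => tsum_nonneg fun p => hnn (s, p)) (fun s => ?_)
    (hu.mul_right (D * E))
  have hs : ∑' p : ℕ × ℕ, F (s, p) = u s * ((∑' l, f s l) * ∑' h, g s h) := by
    rw [(hf s).tsum_mul_tsum (hg s) (hprod s), ← tsum_mul_left]
  rw [hs]
  exact mul_le_mul_of_nonneg_left (mul_le_mul (hD s) (hE s) (tsum_nonneg (hg0 s))
    ((tsum_nonneg (hf0 s)).trans (hD s))) (hu0 s)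

/-- The sums over `l` and `h` and the factor `1 / (y;y)_n` are bounded uniformly, and `y ^ (s.choose
2)` makes the sum over `s` converge for every `ω`. -/
theorem summable_countTerm {μ ν ω q : ℝ} {a b c k : ℕ} (hμ0 : 0 ≤ μ) (hν0 : 0 ≤ ν) (hω0 : 0 ≤ ω)
    (hq0 : 0 ≤ q) (hq1 : q < 1) (hk : 0 < k) (hμ : μ * q ^ a < 1)
    (hν : Summable fun h : ℕ => if H (h + 1) then (ν * q ^ b) ^ (h + 1) else 0) :
    Summable fun p : ℕ × ℕ × ℕ => countTerm H μ ν ω q a b c k p.1 p.2.1 p.2.2 := by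
  set y := q ^ k with hy
  have hy0 : 0 ≤ y := pow_nonneg hq0 k
  have hy1 : y < 1 := pow_lt_one₀ hq0 hq1 hk.ne'
  set α := μ * q ^ a with hα
  set β := ν * q ^ b with hβ
  set γ := ω * q ^ c with hγ
  have hα0 : 0 ≤ α := by positivity
  have hβ0 : 0 ≤ β := by positivity
  have hγ0 : 0 ≤ γ := by positivity
  have hαs : Summable fun h : ℕ => if True then α ^ (h + 1) else 0 := by
    simpa using (summable_nat_add_iff 1).2 (summable_geometric_of_lt_one hα0 hμ)
  set M := ∑' h : ℕ, (if True then α ^ (h + 1) else 0) with hM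
  set N := ∑' h : ℕ, (if H (h + 1) then β ^ (h + 1) else 0) with hN
  have hM0 : 0 ≤ M := tsum_nonneg fun h => by split_ifs <;> positivity
  have hN0 : 0 ≤ N := tsum_nonneg fun h => by split_ifs <;> positivity
  have hA := summable_pow_mul_blockSum (H := fun _ => True) hy0 hy1 hα0 hαs hM.ge
  have hB := summable_pow_mul_blockSum (H := H) hy0 hy1 hβ0 hν hN.ge
  have hA0 : ∀ s l, 0 ≤ α ^ l * blockSum (fun _ => True) y s l := fun s l =>
    mul_nonneg (by positivity) (blockSum_nonneg hy0 s l)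
  have hB0 : ∀ s h, 0 ≤ β ^ h * blockSum H y s h := fun s h =>
    mul_nonneg (by positivity) (blockSum_nonneg hy0 s h)
  have hmain := summable_mul_mul_of_tsum_le (summable_pow_mul_pow_choose_two hy0 hy1 hγ0)
    (fun s => by positivity) hA0 hB0 (fun s => (hA s).1) (fun s => (hB s).1)
    (fun s => (hA s).2.trans (Real.exp_le_exp.2
      (mul_le_mul_of_nonneg_left (geom_sum_le_inv hy0 hy1 _) hM0)))
    (fun s => (hB s).2.trans (Real.exp_le_exp.2
      (mul_le_mul_of_nonneg_left (geom_sum_le_inv hy0 hy1 _) hN0)))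
  have hform : ∀ p : ℕ × ℕ × ℕ, countTerm H μ ν ω q a b c k p.1 p.2.1 p.2.2 =
      1 / qPochhammer y y (p.1 + p.2.1 + p.2.2) * ((γ ^ p.1 * y ^ p.1.choose 2) *
      ((α ^ p.2.1 * blockSum (fun _ => True) y p.1 p.2.1) *
        (β ^ p.2.2 * blockSum H y p.1 p.2.2))) := by
    intro p
    rw [countTerm]
    ring
  have hnn : ∀ p : ℕ × ℕ × ℕ, 0 ≤ (γ ^ p.1 * y ^ p.1.choose 2) *
      ((α ^ p.2.1 * blockSum (fun _ => True) y p.1 p.2.1) *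
        (β ^ p.2.2 * blockSum H y p.1 p.2.2)) := fun p =>
    mul_nonneg (by positivity) (mul_nonneg (hA0 _ _) (hB0 _ _))
  refine Summable.of_nonneg_of_le (fun p => ?_) (fun p => ?_)
    (hmain.mul_left (Real.exp ((1 - y)⁻¹ * (1 - y)⁻¹)))
  · rw [hform]
    exact mul_nonneg (one_div_nonneg.2 (inv_qPochhammer_le hy0 hy1 _).1.le) (hnn p)
  · rw [hform]
    refine mul_le_mul_of_nonneg_right ((inv_qPochhammer_le hy0 hy1 _).2.trans ?_) (hnn p)
    exact Real.exp_le_exp.2 (mul_le_mul_of_nonneg_right (geom_sum_le_inv hy0 hy1 _)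
      (inv_nonneg.2 (by linarith)))

end RealBounds

/-! ### The two classes of partitions in terms of words. -/

section Classes

variable {a b c k : ℕ} (ha : 1 ≤ a) (hab : a < b) (hbc : b < c) (hck : c ≤ k)
include ha hab hbc hck

theorem mem_classR_iff (π : List ℕ) :
    π ∈ classR a b c k ↔
      IsIncreasing a b c k π.reverse ∧ NoBA (π.reverse.map (Letter.of a b k)) := by
  have hinc : IsIncreasing a b c k π.reverse ↔ IsPartition π ∧
      (∀ x ∈ π, x ≡ a [MOD k] ∨ x ≡ b [MOD k] ∨ x ≡ c [MOD k]) ∧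
      (π.filter (fun x => decide (x ≡ c [MOD k]))).Nodup := by
    unfold IsIncreasing IsPartition List.Nodup
    rw [List.pairwise_reverse, List.pairwise_filter]
    simp only [List.mem_reverse, decide_eq_true_eq]
    constructor
    · rintro ⟨h1, h2⟩
      refine ⟨⟨h1.imp fun h => h.1, fun x hx => ?_⟩, fun x hx => ?_, h1.imp ?_⟩
      · obtain ⟨d, X, rfl⟩ := h2 x hx
        exact Nat.add_pos_right _ (res_pos ha hab hbc X)
      · obtain ⟨d, X, rfl⟩ := h2 x hx
        have h := mul_add_res_modEq_iff ha hab hbc hck d X X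
        cases X
        · exact Or.inl (h.2 rfl)
        · exact Or.inr (Or.inl (h.2 rfl))
        · exact Or.inr (Or.inr (h.2 rfl))
      · intro x y h _ hy e
        exact h.2 hy e.symm
    · rintro ⟨⟨h1, h2⟩, h3, h4⟩
      refine ⟨h1.imp₂ ?_ h4, fun x hx =>
        exists_eq_mul_add_res ha hab hbc hck (h2 x hx) (h3 x hx)⟩
      intro x y h h'
      exact ⟨h, fun hc e => h' (e ▸ hc) hc e.symm⟩
  have hletter : ∀ x ∈ π, (x ≡ a [MOD k] ∨ x ≡ b [MOD k] ∨ x ≡ c [MOD k]) → 0 < x →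
      ((x ≡ a [MOD k] ↔ Letter.of a b k x = A) ∧
        (x ≡ a [MOD k] ∨ x ≡ c [MOD k] ↔ Letter.of a b k x ≠ B)) := by
    intro x _ hx hx0
    obtain ⟨d, X, rfl⟩ := exists_eq_mul_add_res ha hab hbc hck hx0 hx
    have hA := mul_add_res_modEq_iff ha hab hbc hck d X A
    have hC := mul_add_res_modEq_iff ha hab hbc hck d X C
    rw [res_A] at hA
    rw [res_C] at hC
    rw [hA, hC, of_mul_add_res ha hab hbc hck]
    cases X <;> simp
  rw [hinc]
  have key : (IsPartition π ∧
      (∀ x ∈ π, x ≡ a [MOD k] ∨ x ≡ b [MOD k] ∨ x ≡ c [MOD k])) →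
      ((∀ (i : ℕ) (hi : i + 1 < π.length),
        π[i] ≡ a [MOD k] → π[i + 1] ≡ a [MOD k] ∨ π[i + 1] ≡ c [MOD k]) ↔
      NoBA (π.reverse.map (Letter.of a b k))) := by
    rintro ⟨hp, hr⟩
    unfold NoBA
    rw [List.isChain_map, List.isChain_reverse, List.isChain_iff_getElem]
    refine forall₂_congr fun i hi => ?_
    have m1 : π[i] ∈ π := List.getElem_mem _
    have m2 : π[i + 1] ∈ π := List.getElem_mem _
    rw [(hletter _ m1 (hr _ m1) (hp.2 _ m1)).1, (hletter _ m2 (hr _ m2) (hp.2 _ m2)).2]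
    tauto
  simp only [classR, Set.mem_ofPred_eq]
  tauto

theorem mem_classR_iff_validWord (π : List ℕ) :
    π ∈ classR a b c k ↔ IsIncreasing a b c k π.reverse ∧
      ValidWord (fun _ => True) (π.reverse.map (Letter.of a b k)) := by
  rw [mem_classR_iff ha hab hbc hck]
  simp [ValidWord]

theorem mem_classRr_iff_validWord (r : ℕ) (π : List ℕ) :
    π ∈ classRr a b c k r ↔ IsIncreasing a b c k π.reverse ∧
      ValidWord (fun i => i < r) (π.reverse.map (Letter.of a b k)) := by
  simp only [classRr, Set.mem_ofPred_eq, mem_classR_iff ha hab hbc hck, ValidWord, and_assoc]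
  refine and_congr_right fun hinc => and_congr_right fun _ => ?_
  have hrun : ∀ i, List.replicate i B <:+: π.reverse.map (Letter.of a b k) ↔
      ∃ l : List ℕ, l <:+: π ∧ l.length = i ∧ ∀ x ∈ l, x ≡ b [MOD k] := by
    intro i
    rw [← List.map_reverse.symm, ← List.reverse_infix, List.reverse_reverse,
      List.reverse_replicate, List.infix_map_iff]
    refine exists_congr fun l => and_congr_right fun hl => ?_
    rw [eq_comm, List.eq_replicate_iff, List.length_map]
    refine and_congr_right fun _ => ?_
    simp only [List.mem_map, forall_exists_index, and_imp, forall_apply_eq_imp_iff₂]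
    refine forall₂_congr fun x hx => ?_
    obtain ⟨d, X, rfl⟩ := hinc.2 x (List.mem_reverse.2 (hl.subset hx))
    have h := mul_add_res_modEq_iff ha hab hbc hck d X B
    rw [res_B] at h
    rw [h, of_mul_add_res ha hab hbc hck]
  simp only [hrun]
  constructor
  · rintro h i ⟨l, h1, h2, h3⟩
    by_contra hi
    -- A run of length at least `r` contains one of length exactly `r`.
    refine h ⟨l.take r, (List.take_prefix r l).isInfix.trans h1, ?_,
      fun x hx => h3 x (List.mem_of_mem_take hx)⟩
    rw [List.length_take]
    omega
  · rintro h ⟨l, h1, h2, h3⟩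
    exact lt_irrefl r (h r ⟨l, h1, h2, h3⟩)

end Classes

/-! ### From triple sums to the series over `m`. -/

section Analysis

variable {𝕜 : Type*} [NormedField 𝕜]

theorem qPochhammer_ne_zero {z : 𝕜} (hz : ‖z‖ < 1) (n : ℕ) : qPochhammer z z n ≠ 0 := by
  refine prod_ne_zero_iff.2 fun i _ h => ?_
  have h1 : z ^ (i + 1) = 1 := by rw [pow_succ', ← sub_eq_zero.1 h]
  have h2 : ‖z ^ (i + 1)‖ < 1 := by
    rw [norm_pow]
    exact pow_lt_one₀ (norm_nonneg _) hz (by omega)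
  rw [h1, norm_one] at h2
  exact lt_irrefl _ h2

theorem partWeight_reverse (μ ν ω q : 𝕜) (a b c k : ℕ) (π : List ℕ) :
    partWeight μ ν ω q a b c k π.reverse = partWeight μ ν ω q a b c k π := by
  simp [partWeight, numParts, List.sum_reverse]

theorem hasSum_class [CompleteSpace 𝕜] {a b c k : ℕ} (ha : 1 ≤ a) (hab : a < b) (hbc : b < c)
    (hck : c ≤ k) {H : ℕ → Prop} [DecidablePred H] (hH : ∀ i j, i ≤ j → H j → H i)
    {μ ν ω q : 𝕜} (hq : ‖q‖ < 1) (hμ : ‖μ * q ^ a‖ < 1)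
    (hν : Summable fun h : ℕ => if H (h + 1) then ‖ν * q ^ b‖ ^ (h + 1) else 0)
    {S : Set (List ℕ)} (hS : ∀ π, π ∈ S ↔ IsIncreasing a b c k π.reverse ∧
      ValidWord H (π.reverse.map (Letter.of a b k))) :
    ∃ Z, HasSum (fun p : ℕ × ℕ × ℕ => countTerm H μ ν ω q a b c k p.1 p.2.1 p.2.2) Z ∧
      HasSum (fun π : S => partWeight μ ν ω q a b c k (π : List ℕ)) Z := by
  have hqn : ‖‖q‖‖ < 1 := by rwa [norm_norm]
  have hN : ∀ p : ℕ × ℕ × ℕ, HasSum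
      (fun ρ : partsOfCounts H a b c k p.1 p.2.1 p.2.2 =>
        ‖partWeight μ ν ω q a b c k (ρ : List ℕ)‖)
      (countTerm H ‖μ‖ ‖ν‖ ‖ω‖ ‖q‖ a b c k p.1 p.2.1 p.2.2) := by
    intro p
    simp only [norm_partWeight]
    exact hasSum_partsOfCounts ha hab hbc hck hH ‖μ‖ ‖ν‖ ‖ω‖ hqn _ _ _
  have hNs := summable_countTerm (H := H) (b := b) (c := c) (k := k) (norm_nonneg μ)
    (norm_nonneg ν) (norm_nonneg ω) (norm_nonneg q) hq (by omega) (by simpa using hμ)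
    (by simpa using hν)
  obtain ⟨Z, hZ1, hZ2⟩ := hasSum_iUnion_of_norm
    (T := fun p : ℕ × ℕ × ℕ => partsOfCounts H a b c k p.1 p.2.1 p.2.2)
    (pairwise_disjoint_partsOfCounts ha hab hbc hck hH) hN hNs
    (fun p => hasSum_partsOfCounts ha hab hbc hck hH μ ν ω hq _ _ _)
  refine ⟨Z, hZ1, ?_⟩
  let e : S ≃ (⋃ p : ℕ × ℕ × ℕ, partsOfCounts H a b c k p.1 p.2.1 p.2.2 : Set (List ℕ)) :=
    (List.reverse_involutive.toPerm).subtypeEquiv fun π =>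
      (hS π).trans (mem_iUnion_partsOfCounts_iff ha hab hbc hck hH π.reverse).symm
  rw [← e.hasSum_iff] at hZ2
  convert hZ2 using 2 with π
  exact (partWeight_reverse μ ν ω q a b c k _).symm

/-- Substitute `m = s + l + h`; the triples `(m, s, h)` that are missed have `m < s + h`. -/
theorem hasSum_tsum_tsum_of_hasSum_reindex {t : ℕ → ℕ → ℕ → 𝕜}
    (ht : ∀ m s h, m < s + h → t m s h = 0) {Z : 𝕜}
    (hZ : HasSum (fun p : ℕ × ℕ × ℕ => t (p.1 + p.2.1 + p.2.2) p.1 p.2.2) Z) :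
    HasSum (fun m => ∑' s, ∑' h, t m s h) Z := by
  let g : ℕ × ℕ × ℕ → ℕ × ℕ × ℕ := fun p => (p.1 + p.2.1 + p.2.2, p.1, p.2.2)
  have hg : Function.Injective g := by
    rintro ⟨s, l, h⟩ ⟨s', l', h'⟩ e
    simp only [g, Prod.mk.injEq] at e ⊢
    omega
  have h1 : HasSum (fun x : ℕ × ℕ × ℕ => t x.1 x.2.1 x.2.2) Z := by
    refine (hg.hasSum_iff fun x hx => ht _ _ _ ?_).1 hZ
    by_contra hlt
    refine hx ⟨(x.2.1, x.1 - x.2.1 - x.2.2, x.2.2), ?_⟩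
    simp only [g]
    ext <;> simp only <;> omega
  refine h1.prod_fiberwise fun m => ?_
  have hs : Summable fun x : ℕ × ℕ => t m x.1 x.2 := by
    refine summable_of_ne_finset_zero (s := range (m + 1) ×ˢ range (m + 1)) fun x hx => ht _ _ _ ?_
    simp only [mem_product, mem_range] at hx
    omega
  have hrow : ∀ s, Summable fun h => t m s h := by
    intro s
    refine summable_of_ne_finset_zero (s := range (m + 1)) fun h hh => ht _ _ _ ?_
    simp only [mem_range] at hh
    omega
  rw [← hs.tsum_prod' hrow]
  exact hs.hasSum

theorem pnat_series_of_hasSum {T : ℕ → 𝕜} {Z : 𝕜} (hT : HasSum T Z) (h0 : T 0 = 1) :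
    Summable (fun m : ℕ+ => T m) ∧ Z = 1 + ∑' m : ℕ+, T m := by
  refine ⟨summable_pnat_iff_summable_succ.2 ((summable_nat_add_iff 1).2 hT.summable), ?_⟩
  rw [tsum_pnat_eq_tsum_succ (f := T), ← h0, ← hT.summable.tsum_eq_zero_add, hT.tsum_eq]

theorem monomialFactor_add (μ ν ω q : 𝕜) (a b c k s l h : ℕ) :
    monomialFactor μ ν ω q a b c k (s + l + h) s h =
      (μ * q ^ a) ^ l * (ν * q ^ b) ^ h * (ω * q ^ c) ^ s * (q ^ k) ^ s.choose 2 := by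
  have e1 : ((s + l + h : ℕ) : ℤ) - h - s = (l : ℤ) := by push_cast; ring
  unfold monomialFactor
  rw [e1, int_mul_sq_sub_div_two, zpow_natCast,
    show (l : ℤ) * a + h * b + s * c + ((k * s.choose 2 : ℕ) : ℤ) =
      ((l * a + h * b + s * c + k * s.choose 2 : ℕ) : ℤ) by push_cast; ring, zpow_natCast]
  ring

theorem series_eq_of_countTerm [CompleteSpace 𝕜] {a b c k : ℕ} (ha : 1 ≤ a) (hab : a < b)
    (hbc : b < c) (hck : c ≤ k) {H : ℕ → Prop} [DecidablePred H]
    (hH : ∀ i j, i ≤ j → H j → H i) (hH0 : H 0)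
    {μ ν ω q : 𝕜} (hq : ‖q‖ < 1) (hμ : ‖μ * q ^ a‖ < 1)
    (hν : Summable fun h : ℕ => if H (h + 1) then ‖ν * q ^ b‖ ^ (h + 1) else 0)
    {S : Set (List ℕ)} (hS : ∀ π, π ∈ S ↔ IsIncreasing a b c k π.reverse ∧
      ValidWord H (π.reverse.map (Letter.of a b k)))
    {t : ℕ → ℕ → ℕ → 𝕜} (ht : ∀ m s h, m < s + h → t m s h = 0)
    (htc : ∀ s l h, 1 / qPochhammer (q ^ k) (q ^ k) (s + l + h) * t (s + l + h) s h =
      countTerm H μ ν ω q a b c k s l h) {T : ℕ → 𝕜}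
    (hT : ∀ m, T m = 1 / qPochhammer (q ^ k) (q ^ k) m * ∑' s, ∑' h, t m s h) :
    Summable (fun π : S => partWeight μ ν ω q a b c k (π : List ℕ)) ∧
      Summable (fun m : ℕ+ => T m) ∧
      ∑' π : S, partWeight μ ν ω q a b c k (π : List ℕ) = 1 + ∑' m : ℕ+, T m := by
  obtain ⟨Z, hZ1, hZ2⟩ := hasSum_class ha hab hbc hck hH hq hμ hν hS
  have hZ3 := hasSum_tsum_tsum_of_hasSum_reindex
    (t := fun m s h => 1 / qPochhammer (q ^ k) (q ^ k) m * t m s h)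
    (fun m s h hm => by rw [ht m s h hm, mul_zero]) (by simpa only [htc] using hZ1)
  have hTZ : HasSum T Z := by
    simp only [tsum_mul_left] at hZ3
    rwa [funext hT]
  -- The term `m = 0` is the empty partition, the isolated `1` in the formulas.
  have hT0 : T 0 = 1 := by
    rw [hT, tsum_eq_single 0, tsum_eq_single 0]
    · have := htc 0 0 0
      rw [show 0 + 0 + 0 = 0 from rfl] at this
      rw [this]
      simp [countTerm, blockSum, hH0, qPochhammer]
    · intro h hh
      exact ht 0 0 h (by omega)
    · intro s hs
      simp [ht 0 s _ (Nat.add_pos_left (Nat.pos_of_ne_zero hs) _)]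
  obtain ⟨h1, h2⟩ := pnat_series_of_hasSum hTZ hT0
  exact ⟨hZ2.summable, h1, hZ2.tsum_eq.trans h2⟩

end Analysis

theorem mainTheorem2 {𝕜 : Type*} [NormedField 𝕜] [CompleteSpace 𝕜] (a b c k r : ℕ)
    (ha : 1 ≤ a) (hab : a < b) (hbc : b < c) (hck : c ≤ k) (hr : 1 ≤ r)
    (μ ν ω q : 𝕜) (hq : ‖q‖ < 1) (hμ : ‖μ * q ^ a‖ < 1) :
    (‖ν * q ^ b‖ < 1 →
      Summable (fun π : classR a b c k => partWeight μ ν ω q a b c k (π : List ℕ)) ∧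
      Summable (fun m : ℕ+ => termR μ ν ω q a b c k m) ∧
      ∑' π : classR a b c k, partWeight μ ν ω q a b c k (π : List ℕ) =
        1 + ∑' m : ℕ+, termR μ ν ω q a b c k m) ∧
    (Summable (fun π : classRr a b c k r => partWeight μ ν ω q a b c k (π : List ℕ)) ∧
      Summable (fun m : ℕ+ => termRr μ ν ω q a b c k r m) ∧
      ∑' π : classRr a b c k r, partWeight μ ν ω q a b c k (π : List ℕ) =
        1 + ∑' m : ℕ+, termRr μ ν ω q a b c k r m) := by
  have hpow : ∀ n, 0 < n → ‖q ^ n‖ < 1 := fun n hn => by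
    rw [norm_pow]
    exact pow_lt_one₀ (norm_nonneg _) hq hn.ne'
  have hy := qPochhammer_ne_zero (hpow k (by omega))
  have hz := qPochhammer_ne_zero (hpow (r * k) (Nat.mul_pos hr (by omega)))
  have hbinom : ∀ s l h : ℕ, qBinom q k (((s + l + h : ℕ) : ℤ) - h) s =
      blockSum (fun _ => True) (q ^ k) s l := by
    intro s l h
    rw [blockSum_true_eq_gaussBinom hy, ← qBinom_natCast]
    congr 1
    push_cast
    ring
  -- This factor removes every term in which `μ` would have a negative exponent.
  have hvanish : ∀ m s h : ℕ, m < s + h → qBinom q k ((m : ℤ) - h) s = 0 := fun m s h hm =>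
    qBinom_of_neg_lt _ _ (by omega)
  refine ⟨fun hν => ?_, ?_⟩
  · refine series_eq_of_countTerm ha hab hbc hck (H := fun _ => True) (fun _ _ _ h => h) trivial
      hq hμ ?_ (mem_classR_iff_validWord ha hab hbc hck)
      (t := fun m s h => monomialFactor μ ν ω q a b c k m s h *
        qBinom q k ((h : ℤ) + s) s * qBinom q k ((m : ℤ) - h) s)
      (fun m s h hm => by rw [hvanish m s h hm, mul_zero]) (fun s l h => ?_) (fun m => rfl)
    · simpa using (summable_nat_add_iff 1).2 (summable_geometric_of_lt_one (norm_nonneg _) hν)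
    · rw [hbinom, monomialFactor_add, ← Nat.cast_add, qBinom_natCast,
        ← blockSum_true_eq_gaussBinom hy, countTerm]
      ring
  · refine series_eq_of_countTerm ha hab hbc hck (H := fun i => i < r)
      (fun _ _ h1 h2 => lt_of_le_of_lt h1 h2) hr
      hq hμ ?_ (mem_classRr_iff_validWord ha hab hbc hck r)
      (t := fun m s h => monomialFactor μ ν ω q a b c k m s h *
        qBinom q k ((m : ℤ) - h) s * gSum q k r h ((s : ℤ) + 1))
      (fun m s h hm => by rw [hvanish m s h hm, mul_zero, zero_mul]) (fun s l h => ?_)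
      (fun m => rfl)
    -- Runs of `B` are shorter than `r`, so this sum is finite and `ν` needs no bound.
    · refine summable_of_ne_finset_zero (s := range r) fun h hh => if_neg ?_
      simp only [mem_range] at hh
      omega
    · rw [hbinom, monomialFactor_add, gSum_eq_blockSum hy hz, countTerm]
      ring
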